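/- Work on the triangular lattice with one family of lattice lines horizontal. Use coordinates $(i,j)$ whose $i$-axis is a horizontal lattice line, with unit half the side of a unit triangle, and whose $j$-axis is vertical through a lattice vertex (the origin), with unit the height of a unit triangle. A lozenge is a union of two unit triangles sharing an edge; it is vertical if the shared edge is horizontal. A vertical lozenge with center $(i,j)$ has weight $\operatorname{wt}_1(i,j)=\frac{q^i+q^{-i}}{2}$, where $q$ is an indeterminate; all other lozenges have weight $1$. The weight of a lozenge tiling is the product of the weights of its lozenges, and the tiling generating function $\operatorname{M}(R)$ of a region $R$ is the sum of the weights of all its tilings (so $\operatorname{M}(R)=0$ if there is no tiling and $\operatorname{M}(R)=1$ if $R$ has empty interior). Let $x,d,m$ be non-negative integers with $d\ge m$ and let $1\le l_1<l_2<\dots<l_m\le d$ be integers. The region $B_{x,d}(l_1,\dots,l_m)$ is defined as follows. Start with the halved hexagon whose north, northeast, southeast and south sides have lengths $x$, $2d-m+1$, $m$, $x+d-m$ and run through the points $(1,2d+1)$, $(2x+1,2d+1)$, $(2x+2d-m+2,m)$, $(2(x+d-m)+2,0)$, $(2,0)$ in this order, and whose west side is the vertical zigzag $(1,2d+1),(0,2d),(1,2d-1),(0,2d-2),\dots,(1,3),(0,2),(2,0)$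 with $2d$ steps (if $d=0$, the single segment from $(1,1)$ to $(2,0)$); the bottom-most step has length $2$ and all others have length $1$. For $1\le k\le d$ the $k$-th bump (from bottom to top) of the west side is the one with leftmost vertex $(0,2k)$. For every $k\in\{1,\dots,d\}\setminus\{l_1,\dots,l_m\}$ remove the up-pointing unit triangle with vertices $(0,2k),(2,2k),(1,2k+1)$. Write $[n]_p=1+p+\dots+p^{n-1}$, $[n]_p!=[1]_p[2]_p\cdots[n]_p$, $\left\langle\begin{matrix}b\\a\end{matrix}\right\rangle=a+(a+1)+\dots+b$ for $0\le a\le b$, and $f(t,y,z)=\frac{yz(2t+y-z)}{2}$. For sequences $\mathbf l=(l_i)_{i=1}^m$ and $\mathbf h=(h_j)_{j=1}^n$ put $e'=\min(u-n,d-m+1)$, $\tilde x=x+u-n+d-m-e'$, $t_1'=2(x+u-n-e')+1$, $t_2'=2(x+d-m+1-e')$, \begin{align*} E'&=f(t_1'+2d-m,n+1,m)+\sum_{i=1}^{m}\left\langle\begin{matrix}t_1'+2d-m-(m-i+1)\\ t_1'+2(d-l_i)-2(m-i)\end{matrix}\right\rangle+\sum_{i=1}^{n}\left\langle\begin{matrix}t_2'+2u-n-(n-i+1)\\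 t_2'+2(u-h_i)-2(n-i)\end{matrix}\right\rangle,\\ F'&=(n+1)m+\sum_{i=1}^m(2l_i-i)+\sum_{i=1}^n(2h_i-i), \end{align*} and \begin{align*} Q(x,u,d,\mathbf l,\mathbf h)&=2^{-F'}q^{-E'}\,\frac{\prod_{1\le i<j\le m}[2(l_j-l_i)]_{q^2}\prod_{1\le i<j\le n}[2(h_j-h_i)]_{q^2}}{\prod_{i=1}^m\prod_{j=1}^n[2(l_i+h_j)]_{q^2}\prod_{i=1}^m[2l_i]_{q^2}!\prod_{j=1}^n[2h_j-1]_{q^2}!}\\ &\times\prod_{i=1}^{\lceil n/2\rceil}\prod_{j=1}^{2n-4i+3}[2\tilde x+2i+j]_{q^2}\\ &\times\prod_{i=1}^m[2(\tilde x+n+i)]_{q^2}[2(\tilde x+n+i+1)]_{q^2}\prod_{i=1}^m\prod_{j=1}^{n+i-1}[2\tilde x+n+i+j+1]_{q^2}\\ &\times\prod_{i=1}^n\prod_{j=1}^m\frac{[2(\tilde x+i+j-1)]_{q^2}}{[2(\tilde x+i+j-1)+1]_{q^2}}\\ &\times\prod_{i=1}^m\prod_{j=1}^{l_i-i}[2(\tilde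 x+i+j+n+1)]_{q^2}[2(\tilde x-i-j+m+1)]_{q^2}\\ &\times\prod_{i=1}^n\prod_{j=1}^{h_i-i}[2(\tilde x+i+j+m)]_{q^2}[2(\tilde x-i-j+n+2)]_{q^2}. \end{align*} **Theorem (formula for a region of type B).** For all such $x,d,m$ and $(l_i)_{i=1}^m$, as an identity in $\mathbb{Q}(q)$, $$\operatorname{M}(B_{x,d}(l_1,l_2,\dots,l_m))=Q(x,0,d,(l_i)_{i=1}^m,\emptyset),$$ where $\emptyset$ is the empty sequence ($u=n=0$). -/

import Mathlib

namespace HalvedHexagon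

/-!
Triangular lattice.  In the coordinates used here a horizontal unit is half the side of a unit
triangle and a vertical unit is its height.  The lattice vertices are the points `(a, b)` of `ℤ × ℤ`
with `a + b` even, two of them being neighbours if they differ by `±(2, 0)`, `±(1, 1)`, `±(1, -1)`.
-/

/-- A unit triangle is given by the pair `(i, j)`, where `j` is the height of its lower side or
lower vertex (so it lies in the strip between heights `j` and `j + 1`) and `i` is the abscissa of
its vertical axis of symmetry. It is up-pointing if `i + j` is odd and down-pointing if `i + j` is
even. -/
abbrev Tri := ℤ × ℤ

/-- The three vertices of a unit triangle. -/
def verts (t : Tri) : Finset (ℤ × ℤ) :=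
  if Odd (t.1 + t.2) then {(t.1 - 1, t.2), (t.1 + 1, t.2), (t.1, t.2 + 1)}
  else {(t.1, t.2), (t.1 - 1, t.2 + 1), (t.1 + 1, t.2 + 1)}

/-- A lozenge is the union of two unit triangles sharing an edge; it is written as the pair
(up-pointing triangle, down-pointing triangle). -/
abbrev Lozenge := Tri × Tri

/-- The lozenges contained in the region `R` (a finite set of unit triangles). The up-pointing
triangle `(i, j)` shares its left, right, lower side with the down-pointing triangle
`(i - 1, j)`, `(i + 1, j)`, `(i, j - 1)`, respectively. -/
def lozenges (R : Finset Tri) : Finset Lozenge :=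
  (R ×ˢ R).filter fun L =>
    Odd (L.1.1 + L.1.2) ∧
      (L.2 = (L.1.1 - 1, L.1.2) ∨ L.2 = (L.1.1 + 1, L.1.2) ∨ L.2 = (L.1.1, L.1.2 - 1))

/-- The lozenge tilings of `R`: the sets of lozenges contained in `R` such that every unit triangle
of `R` belongs to exactly one of them. -/
def tilings (R : Finset Tri) : Finset (Finset Lozenge) :=
  (lozenges R).powerset.filter fun T =>
    ∀ t ∈ R, (T.filter fun L => t = L.1 ∨ t = L.2).card = 1

variable {K : Type*} [Field K]

/-- The symmetric weight of a vertical lozenge with center `(i, j)`. -/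
def wt₁ (q : K) (i _j : ℤ) : K := (q ^ i + q ^ (-i)) / 2

/-- The weight of a lozenge: the symmetric weight for a vertical lozenge (its center is the midpoint
`(i, j)` of the lower side of its up-pointing triangle `(i, j)`), and `1` for any other lozenge. -/
def lozengeWeight (q : K) (L : Lozenge) : K :=
  if L.2 = (L.1.1, L.1.2 - 1) then wt₁ q L.1.1 L.1.2 else 1

/-- The tiling generating function of the region `R` with the symmetric weight. -/
noncomputable def tilingGF (q : K) (R : Finset Tri) : K :=
  ∑ T ∈ tilings R, ∏ L ∈ T, lozengeWeight q L

/-!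
The region of type B.  Its corners are `(1, 2d+1)` (top left), `(2x+1, 2d+1)` (top right),
`(2x+2d-m+2, m)` (east), `(2(x+d-m)+2, 0)` (bottom right) and `(2, 0)` (bottom left), so that its
north, northeast, southeast and south sides have lengths `x`, `2d-m+1`, `m`, `x+d-m`.  From the top,
the west side runs through `(1, 2d+1), (0, 2d), (1, 2d-1), (0, 2d-2), …, (1, 3), (0, 2), (2, 0)`: it
has `2d` steps, the last of length `2` and all others of length `1`, and it touches the vertical
axis, from the right, at the `d` points `(0, 2k)`.
-/

/-- The abscissa of the west side at the integer height `y`. -/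
def west (y : ℤ) : ℤ := if y = 0 then 2 else if Even y then 0 else 1

/-- The abscissa of the east side (northeast side above, southeast side below) at height `y`. -/
noncomputable def east (x d m : ℕ) (y : ℤ) : ℤ :=
  min (2 * x + 1 + (2 * d + 1 - y)) (2 * (x + d - m) + 2 + y)

/-- The unit triangles between heights `0` and `2d + 1` whose vertices lie between the west and the
east side. -/
noncomputable def fullRegion (x d m : ℕ) : Finset Tri :=
  (Finset.Icc (0 : ℤ) (2 * x + 2 * d + 2) ×ˢ Finset.Icc (0 : ℤ) (2 * d)).filter fun t =>
    ∀ v ∈ verts t, west v.2 ≤ v.1 ∧ v.1 ≤ east x d m v.2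

/-- The bounding box in the definition of `fullRegion` does not cut anything off. -/
theorem mem_fullRegion (x d m : ℕ) (t : Tri) :
    t ∈ fullRegion x d m ↔ (0 ≤ t.2 ∧ t.2 ≤ 2 * d) ∧
      ∀ v ∈ verts t, west v.2 ≤ v.1 ∧ v.1 ≤ east x d m v.2 := by
  have hw : ∀ y, 0 ≤ west y := by intro y; unfold west; split_ifs <;> norm_num
  have he : ∀ y, east x d m y ≤ 2 * x + 1 + (2 * d + 1 - y) := fun y => min_le_left _ _
  simp only [fullRegion, Finset.mem_filter, Finset.mem_product, Finset.mem_Icc]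
  refine ⟨fun h => ⟨h.1.2, h.2⟩, fun h => ⟨⟨?_, h.1⟩, h.2⟩⟩
  obtain ⟨⟨h0, h1⟩, h2⟩ := h
  by_cases ho : Odd (t.1 + t.2)
  · have a := h2 (t.1 - 1, t.2) (by simp [verts, ho])
    have b := h2 (t.1 + 1, t.2) (by simp [verts, ho])
    have := hw t.2
    have := he t.2
    simp only at a b
    constructor <;> linarith
  · have a := h2 (t.1, t.2) (by simp [verts, ho])
    have := hw t.2
    have := he t.2
    simp only at a
    constructor <;> linarith

/-- The `k`-th bump from the bottom (`1 ≤ k ≤ d`) is the one with the vertex `(0, 2k)`; the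
up-pointing unit triangle in it has the vertices `(0, 2k)`, `(2, 2k)`, `(1, 2k + 1)`. These are the
triangles at the bumps that do not occur in the list `l`. -/
def dents (d : ℕ) {m : ℕ} (l : Fin m → ℕ) : Finset Tri :=
  (Finset.Icc 1 d \ Finset.univ.image l).image fun k : ℕ => ((1 : ℤ), 2 * (k : ℤ))

/-- The region `B_{x,d}(l_1, …, l_m)`. -/
noncomputable def regionB (x d : ℕ) {m : ℕ} (l : Fin m → ℕ) : Finset Tri :=
  fullRegion x d m \ dents d l

/-! The product formula. -/

/-- The `q`-integer `[n]_p = 1 + p + ⋯ + p^(n-1)`. -/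
def qInt (p : K) (n : ℤ) : K := ∑ k ∈ Finset.range n.toNat, p ^ k

/-- The `q`-factorial `[n]_p! = [1]_p [2]_p ⋯ [n]_p`. -/
noncomputable def qFact (p : K) (n : ℤ) : K := ∏ k ∈ Finset.Icc (1 : ℤ) n, qInt p k

/-- The sum `a + (a + 1) + ⋯ + b`. -/
noncomputable def bracketSum (b a : ℤ) : ℤ := ∑ k ∈ Finset.Icc a b, k

/-- `f(t, x, y) = x y (2t + x - y) / 2`, which is an integer for all integers `t, x, y`. -/
def fExp (t x y : ℤ) : ℤ := x * y * (2 * t + x - y) / 2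

/-- The one-based entry `l_i` of a list is `l (i - 1)`; this is the one-based index `i`. -/
def idx {m : ℕ} (i : Fin m) : ℤ := (i : ℤ) + 1

/-- `e' = min (u - n, d - m + 1)` -/
noncomputable def ePrime (u d m n : ℕ) : ℤ := min ((u : ℤ) - n) ((d : ℤ) - m + 1)

/-- `x̃ = x + u - n + d - m - e'` -/
noncomputable def xTilde (x u d m n : ℕ) : ℤ := (x : ℤ) + u - n + d - m - ePrime u d m n

/-- The exponent `E'`. -/
noncomputable def EPrime (x u d : ℕ) {m n : ℕ} (l : Fin m → ℕ) (h : Fin n → ℕ) : ℤ :=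
  let t₁ : ℤ := 2 * ((x : ℤ) + u - n - ePrime u d m n) + 1
  let t₂ : ℤ := 2 * ((x : ℤ) + d - m + 1 - ePrime u d m n)
  fExp (t₁ + 2 * d - m) (n + 1) m
    + ∑ i : Fin m, bracketSum (t₁ + 2 * d - m - (m - idx i + 1))
        (t₁ + 2 * (d - l i) - 2 * (m - idx i))
    + ∑ i : Fin n, bracketSum (t₂ + 2 * u - n - (n - idx i + 1))
        (t₂ + 2 * (u - h i) - 2 * (n - idx i))

/-- The exponent `F'`. -/
noncomputable def FPrime {m n : ℕ} (l : Fin m → ℕ) (h : Fin n → ℕ) : ℤ :=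
  ((n : ℤ) + 1) * m + ∑ i : Fin m, (2 * (l i : ℤ) - idx i) + ∑ i : Fin n, (2 * (h i : ℤ) - idx i)

/-- The product `Q(x, u, d, (l_i), (h_j))`. -/
noncomputable def Q (q : K) (x u d : ℕ) {m n : ℕ} (l : Fin m → ℕ) (h : Fin n → ℕ) : K :=
  let X : ℤ := xTilde x u d m n
  (2 : K) ^ (-FPrime l h) * q ^ (-EPrime x u d l h)
  * ((∏ j : Fin m, ∏ i ∈ Finset.univ.filter (· < j), qInt (q ^ 2) (2 * ((l j : ℤ) - l i)))
      * (∏ j : Fin n, ∏ i ∈ Finset.univ.filter (· < j), qInt (q ^ 2) (2 * ((h j : ℤ) - h i)))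
    / ((∏ i : Fin m, ∏ j : Fin n, qInt (q ^ 2) (2 * ((l i : ℤ) + h j)))
      * (∏ i : Fin m, qFact (q ^ 2) (2 * (l i : ℤ)))
      * (∏ j : Fin n, qFact (q ^ 2) (2 * (h j : ℤ) - 1))))
  * (∏ i ∈ Finset.Icc (1 : ℤ) (((n : ℤ) + 1) / 2), ∏ j ∈ Finset.Icc (1 : ℤ) (2 * n - 4 * i + 3),
      qInt (q ^ 2) (2 * X + 2 * i + j))
  * (∏ i : Fin m, qInt (q ^ 2) (2 * (X + n + idx i)) * qInt (q ^ 2) (2 * (X + n + idx i + 1)))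
  * (∏ i : Fin m, ∏ j ∈ Finset.Icc (1 : ℤ) (n + idx i - 1),
      qInt (q ^ 2) (2 * X + n + idx i + j + 1))
  * (∏ i : Fin n, ∏ j : Fin m,
      qInt (q ^ 2) (2 * (X + idx i + idx j - 1)) / qInt (q ^ 2) (2 * (X + idx i + idx j - 1) + 1))
  * (∏ i : Fin m, ∏ j ∈ Finset.Icc (1 : ℤ) (l i - idx i),
      qInt (q ^ 2) (2 * (X + idx i + j + n + 1)) * qInt (q ^ 2) (2 * (X - idx i - j + m + 1)))
  * (∏ i : Fin n, ∏ j ∈ Finset.Icc (1 : ℤ) (h i - idx i),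
      qInt (q ^ 2) (2 * (X + idx i + j + m)) * qInt (q ^ 2) (2 * (X - idx i - j + n + 2)))

end HalvedHexagon

/-!
In a tiling, the lozenges whose two triangles do not share the left side of the up-pointing one form
`m` nonintersecting lattice paths. They start at the up-pointing triangles in the bumps that are not
removed, cross one by one the strips between consecutive lines `i - j = 2c`, leave the region at the
heights `0, …, m - 1`, and get their weights from the vertical lozenges. That the generating
function is the determinant of the path weights is seen without a sign-reversing involution. Among
the leftmost paths let the one starting last move first: its triangle is covered in one of two ways,
and the determinant splits in the same way by linearity in its row, an impossible step producing two
equal rows or a zero row.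

Since all paths start on the line `i = 0`, telescoping with the identity
`⟦a + b⟧ - ⟦a - b⟧ = (q^a + q^(-a)) ⟦b⟧` for `⟦n⟧ = (q^n - q^(-n)) / (q - q⁻¹)` gives their weights
a product form. Up to row factors, the columns are then products of linear forms in points of the
projective line, so that the determinant is a projective Vandermonde determinant times a constant,
which is read off at points where the matrix is triangular. Finally `[n]_{q²} = q^(n-1) ⟦n⟧` turns
`Q` into the same product, the powers of `q` and `2` cancelling against `E'` and `F'`.
-/

namespace HalvedHexagon

open Finset

section Expansion

variable {K : Type*} [Field K] {R : Finset Tri} {T : Finset Lozenge} {L : Lozenge}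

theorem mem_tilings :
    T ∈ tilings R ↔ T ⊆ lozenges R ∧ ∀ t ∈ R, ∃! L, L ∈ T ∧ (t = L.1 ∨ t = L.2) := by
  simp only [tilings, mem_filter, mem_powerset, card_eq_one_iff_existsUnique]

theorem mem_lozenges_sdiff {S : Finset Tri} :
    L ∈ lozenges (R \ S) ↔ L ∈ lozenges R ∧ L.1 ∉ S ∧ L.2 ∉ S := by
  simp only [lozenges, mem_filter, mem_product, mem_sdiff]
  tauto

theorem fst_mem_of_mem_lozenges (hL : L ∈ lozenges R) : L.1 ∈ R := by
  simp only [lozenges, mem_filter, mem_product] at hL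
  exact hL.1.1

theorem snd_mem_of_mem_lozenges (hL : L ∈ lozenges R) : L.2 ∈ R := by
  simp only [lozenges, mem_filter, mem_product] at hL
  exact hL.1.2

theorem erase_mem_tilings (hT : T ∈ tilings R) (hL : L ∈ T) :
    T.erase L ∈ tilings (R \ {L.1, L.2}) := by
  obtain ⟨hTR, hcover⟩ := mem_tilings.1 hT
  refine mem_tilings.2 ⟨fun L' hL' => ?_, fun t ht => ?_⟩
  · obtain ⟨hne, hL'⟩ := mem_erase.1 hL'
    have hdisj : ∀ t ∈ R, t = L'.1 ∨ t = L'.2 → t ∉ ({L.1, L.2} : Finset Tri) :=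
      fun t ht htL' htL =>
        hne ((hcover t ht).unique ⟨hL', htL'⟩ ⟨hL, by simpa using htL⟩)
    exact mem_lozenges_sdiff.2 ⟨hTR hL',
      hdisj _ (fst_mem_of_mem_lozenges (hTR hL')) (Or.inl rfl),
      hdisj _ (snd_mem_of_mem_lozenges (hTR hL')) (Or.inr rfl)⟩
  · obtain ⟨htR, htL⟩ := mem_sdiff.1 ht
    obtain ⟨L', ⟨hL', htL'⟩, huniq⟩ := hcover t htR
    refine ⟨L', ⟨mem_erase.2 ⟨?_, hL'⟩, htL'⟩,
      fun L'' hL'' => huniq L'' ⟨mem_of_mem_erase hL''.1, hL''.2⟩⟩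
    rintro rfl
    exact htL (by simpa using htL')

theorem notMem_of_mem_tilings_sdiff (hT : T ∈ tilings (R \ {L.1, L.2})) : L ∉ T := fun hL => by
  simpa using (mem_lozenges_sdiff.1 ((mem_tilings.1 hT).1 hL)).2.1

theorem insert_mem_tilings (hL : L ∈ lozenges R) (hT : T ∈ tilings (R \ {L.1, L.2})) :
    insert L T ∈ tilings R := by
  obtain ⟨hTR, hcover⟩ := mem_tilings.1 hT
  refine mem_tilings.2 ⟨insert_subset hL fun L' hL' => (mem_lozenges_sdiff.1 (hTR hL')).1,
    fun t ht => ?_⟩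
  by_cases htL : t = L.1 ∨ t = L.2
  · refine ⟨L, ⟨mem_insert_self _ _, htL⟩, fun L' ⟨hL', htL'⟩ => ?_⟩
    refine (mem_insert.1 hL').resolve_right fun hL' => ?_
    have hdisj := (mem_lozenges_sdiff.1 (hTR hL')).2
    rcases htL' with rfl | rfl
    · exact hdisj.1 (by simpa using htL)
    · exact hdisj.2 (by simpa using htL)
  · obtain ⟨L', ⟨hL', htL'⟩, huniq⟩ := hcover t (by simp [ht, htL])
    refine ⟨L', ⟨mem_insert_of_mem hL', htL'⟩, fun L'' ⟨hL'', htL''⟩ => huniq L'' ⟨?_, htL''⟩⟩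
    refine (mem_insert.1 hL'').resolve_left ?_
    rintro rfl
    exact htL htL''

theorem sum_tilings_mem (q : K) (hL : L ∈ lozenges R) :
    ∑ T ∈ tilings R with L ∈ T, ∏ L' ∈ T, lozengeWeight q L' =
      lozengeWeight q L * tilingGF q (R \ {L.1, L.2}) := by
  rw [tilingGF, mul_sum]
  refine sum_bij' (fun T _ => T.erase L) (fun T _ => insert L T) (fun T hT => ?_)
    (fun T hT => ?_) (fun T hT => ?_) (fun T hT => ?_) (fun T hT => ?_)
  · exact erase_mem_tilings (mem_filter.1 hT).1 (mem_filter.1 hT).2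
  · exact mem_filter.2 ⟨insert_mem_tilings hL hT, mem_insert_self _ _⟩
  · exact insert_erase (mem_filter.1 hT).2
  · exact erase_insert (notMem_of_mem_tilings_sdiff hT)
  · exact (mul_prod_erase _ _ (mem_filter.1 hT).2).symm

theorem tilingGF_eq_sum (q : K) {t : Tri} (ht : t ∈ R) :
    tilingGF q R = ∑ L ∈ lozenges R with t = L.1 ∨ t = L.2,
      lozengeWeight q L * tilingGF q (R \ {L.1, L.2}) := by
  calc tilingGF q R
      = ∑ T ∈ tilings R, ∑ L ∈ lozenges R with t = L.1 ∨ t = L.2,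
          if L ∈ T then ∏ L' ∈ T, lozengeWeight q L' else 0 := by
        refine sum_congr rfl fun T hT => ?_
        obtain ⟨hTR, hcover⟩ := mem_tilings.1 hT
        obtain ⟨L, ⟨hL, htL⟩, huniq⟩ := hcover t ht
        rw [sum_eq_single_of_mem L (mem_filter.2 ⟨hTR hL, htL⟩) fun L' hL' hne =>
          if_neg fun h => hne (huniq L' ⟨h, (mem_filter.1 hL').2⟩), if_pos hL]
    _ = _ := by
        rw [sum_comm]
        refine sum_congr rfl fun L hL => ?_
        rw [← sum_filter, sum_tilings_mem q (mem_filter.1 hL).1]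

theorem tilingGF_empty (q : K) : tilingGF q ∅ = 1 := by
  have htilings : tilings ∅ = {∅} := by
    ext T
    simp [mem_tilings, lozenges]
  simp [tilingGF, htilings]

end Expansion

section Triangles

/-- The up-pointing triangle at height `p.2` in the strip between the lines `i - j = 2 * p.1` and
`i - j = 2 * p.1 + 2`. In these strip coordinates the two kinds of triangles are separated, and no
parity condition occurs. -/
def upTri (p : ℤ × ℤ) : Tri := (2 * p.1 + 1 + p.2, p.2)

/-- The down-pointing triangle at height `p.2` in the strip between the lines `i - j = 2 * p.1` and
`i - j = 2 * p.1 + 2`; it is the right neighbour of `upTri p`. -/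
def downTri (p : ℤ × ℤ) : Tri := (2 * p.1 + 2 + p.2, p.2)

/-- The position in the next strip to the left: `downTri (left p)` is the left neighbour of
`upTri p`. -/
def left (p : ℤ × ℤ) : ℤ × ℤ := (p.1 - 1, p.2)

/-- The position in the next strip to the right: `upTri (right p)` is the right neighbour of
`downTri p`. -/
def right (p : ℤ × ℤ) : ℤ × ℤ := (p.1 + 1, p.2)

/-- The position one unit lower in the same strip: `downTri (below p)` is the lower neighbour of
`upTri p`. -/
def below (p : ℤ × ℤ) : ℤ × ℤ := (p.1, p.2 - 1)

theorem right_eq_iff {p e : ℤ × ℤ} : right e = p ↔ e = left p := by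
  simp only [left, right, Prod.ext_iff]
  omega

theorem left_right (p : ℤ × ℤ) : left (right p) = p :=
  (right_eq_iff.1 rfl).symm

theorem below_ne (p : ℤ × ℤ) : below p ≠ p := by
  simp only [below, ne_eq, Prod.ext_iff]
  omega

theorem upTri_injective : Function.Injective upTri := fun p p' h => by
  simp only [upTri, Prod.ext_iff] at h ⊢
  omega

theorem downTri_injective : Function.Injective downTri := fun p p' h => by
  simp only [downTri, Prod.ext_iff] at h ⊢
  omega

theorem upTri_ne_downTri (p p' : ℤ × ℤ) : upTri p ≠ downTri p' := fun h => by
  simp only [upTri, downTri, Prod.mk.injEq] at h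
  omega

theorem exists_upTri_or_downTri (t : Tri) : ∃ p, t = upTri p ∨ t = downTri p := by
  obtain ⟨i, j⟩ := t
  rcases Int.even_or_odd' (i - j) with ⟨c, h | h⟩
  · exact ⟨(c - 1, j), Or.inr (Prod.ext (by simp only [downTri]; omega) rfl)⟩
  · exact ⟨(c, j), Or.inl (Prod.ext (by simp only [upTri]; omega) rfl)⟩

theorem ext_upTri_downTri {R R' : Finset Tri} (hup : ∀ p, upTri p ∈ R ↔ upTri p ∈ R')
    (hdown : ∀ p, downTri p ∈ R ↔ downTri p ∈ R') : R = R' := by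
  ext t
  obtain ⟨p, rfl | rfl⟩ := exists_upTri_or_downTri t
  · exact hup p
  · exact hdown p

theorem odd_upTri (p : ℤ × ℤ) : Odd ((upTri p).1 + (upTri p).2) :=
  ⟨p.1 + p.2, by simp only [upTri]; ring⟩

theorem not_odd_downTri (p : ℤ × ℤ) : ¬ Odd ((downTri p).1 + (downTri p).2) :=
  Int.not_odd_iff_even.2 ⟨p.1 + 1 + p.2, by simp only [downTri]; ring⟩

theorem mem_lozenges {R : Finset Tri} {L : Lozenge} :
    L ∈ lozenges R ↔ ∃ p e, L = (upTri p, downTri e) ∧ (upTri p ∈ R ∧ downTri e ∈ R) ∧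
      (e = left p ∨ e = p ∨ e = below p) := by
  have hadj (p e : ℤ × ℤ) : (downTri e = ((upTri p).1 - 1, (upTri p).2) ∨
      downTri e = ((upTri p).1 + 1, (upTri p).2) ∨ downTri e = ((upTri p).1, (upTri p).2 - 1)) ↔
      (e = left p ∨ e = p ∨ e = below p) := by
    simp only [upTri, downTri, left, below, Prod.ext_iff]
    omega
  simp only [lozenges, mem_filter, mem_product]
  constructor
  · rintro ⟨hR, hodd, hL⟩
    obtain ⟨t, t'⟩ := L
    obtain ⟨p, rfl | rfl⟩ := exists_upTri_or_downTri t
    · obtain ⟨e, rfl | rfl⟩ := exists_upTri_or_downTri t'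
      · have hpar := odd_upTri e
        rw [Int.odd_iff] at hodd hpar
        simp only [Prod.ext_iff] at hL hpar hodd
        omega
      · exact ⟨p, e, rfl, hR, (hadj p e).1 hL⟩
    · exact absurd hodd (not_odd_downTri p)
  · rintro ⟨p, e, rfl, hR, hL⟩
    exact ⟨hR, odd_upTri p, (hadj p e).2 hL⟩

end Triangles

section LocalExpansion

variable {K : Type*} [Field K]

/-- The weight of the vertical lozenge with upper half `upTri p`. -/
def verticalWeight (q : K) (p : ℤ × ℤ) : K := wt₁ q (2 * p.1 + 1 + p.2) p.2

theorem lozengeWeight_upTri_downTri (q : K) (p e : ℤ × ℤ) :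
    lozengeWeight q (upTri p, downTri e) = if e = below p then verticalWeight q p else 1 := by
  have hvertical : downTri e = ((upTri p).1, (upTri p).2 - 1) ↔ e = below p := by
    simp only [upTri, downTri, below, Prod.ext_iff]
    omega
  simp only [lozengeWeight, hvertical]
  rfl

theorem tilingGF_upTri (q : K) {R : Finset Tri} {p : ℤ × ℤ} (hp : upTri p ∈ R)
    (hleft : downTri (left p) ∉ R) :
    tilingGF q R =
      (if downTri p ∈ R then tilingGF q (R \ {upTri p, downTri p}) else 0) +
      verticalWeight q p *
        if downTri (below p) ∈ R then tilingGF q (R \ {upTri p, downTri (below p)}) else 0 := by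
  have hcover : ({L ∈ lozenges R | upTri p = L.1 ∨ upTri p = L.2} : Finset Lozenge) =
      {L ∈ ({(upTri p, downTri p), (upTri p, downTri (below p))} : Finset Lozenge) | L.2 ∈ R} := by
    ext L
    simp only [mem_filter, mem_lozenges, mem_insert, mem_singleton]
    constructor
    · rintro ⟨⟨p', e, rfl, ⟨-, he⟩, hadj⟩, h | h⟩
      · obtain rfl := upTri_injective h
        rcases hadj with rfl | rfl | rfl
        · exact absurd he hleft
        · exact ⟨Or.inl rfl, he⟩
        · exact ⟨Or.inr rfl, he⟩
      · exact absurd h (upTri_ne_downTri _ _)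
    · rintro ⟨rfl | rfl, h⟩ <;> exact ⟨⟨p, _, rfl, ⟨hp, h⟩, by simp⟩, Or.inl rfl⟩
  have hne : (upTri p, downTri p) ≠ (upTri p, downTri (below p)) := by
    simp [downTri_injective.eq_iff, (below_ne p).symm]
  rw [tilingGF_eq_sum q hp, hcover, sum_filter, sum_pair hne]
  simp [lozengeWeight_upTri_downTri, (below_ne p).symm]

theorem tilingGF_downTri (q : K) {R : Finset Tri} {e : ℤ × ℤ} (he : downTri e ∈ R)
    (hleft : upTri e ∉ R) (habove : upTri (e.1, e.2 + 1) ∉ R) (hright : upTri (right e) ∈ R) :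
    tilingGF q R = tilingGF q (R \ {upTri (right e), downTri e}) := by
  have hcover : ({L ∈ lozenges R | downTri e = L.1 ∨ downTri e = L.2} : Finset Lozenge) =
      {(upTri (right e), downTri e)} := by
    ext L
    simp only [mem_filter, mem_lozenges, mem_singleton]
    constructor
    · rintro ⟨⟨p, e', rfl, ⟨hp, -⟩, hadj⟩, h | h⟩
      · exact absurd h.symm (upTri_ne_downTri _ _)
      · obtain rfl := downTri_injective h
        rcases hadj with h | rfl | rfl
        · rw [right_eq_iff.2 h]
        · exact absurd hp hleft
        · exact absurd (by simpa [below] using hp) habove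
    · rintro rfl
      exact ⟨⟨right e, e, rfl, ⟨hright, he⟩, Or.inl (left_right e).symm⟩, Or.inr rfl⟩
  have hne : e ≠ below (right e) := by
    simp only [below, right, ne_eq, Prod.ext_iff]
    omega
  rw [tilingGF_eq_sum q he, hcover, sum_singleton, lozengeWeight_upTri_downTri, if_neg hne,
    one_mul]

end LocalExpansion

section PathRegion

variable {K : Type*} [Field K] {X : ℤ} {A V : Finset (ℤ × ℤ)} {p e : ℤ × ℤ}

/-- The region left to be tiled when a family of lattice paths, which cross the strips from left to
right, has been followed up to the positions in `A` and the down-pointing triangles in `V` are still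
uncovered. It consists of the down-pointing triangles in `V`, their right neighbours and the
up-pointing triangles in `A`, without the up-pointing triangles in the strips after `X`. -/
def pathRegion (X : ℤ) (A V : Finset (ℤ × ℤ)) : Finset Tri :=
  {p ∈ A ∪ V.image right | p.1 ≤ X}.image upTri ∪ V.image downTri

theorem upTri_mem_pathRegion : upTri p ∈ pathRegion X A V ↔ (p ∈ A ∨ left p ∈ V) ∧ p.1 ≤ X := by
  have himage : p ∈ V.image right ↔ left p ∈ V := by
    simp only [mem_image, right_eq_iff, exists_eq_right]
  rw [pathRegion, mem_union, upTri_injective.mem_finset_image, mem_filter, mem_union, himage,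
    or_iff_left]
  simp [fun e => (upTri_ne_downTri p e).symm]

theorem downTri_mem_pathRegion : downTri p ∈ pathRegion X A V ↔ p ∈ V := by
  rw [pathRegion, mem_union, downTri_injective.mem_finset_image, or_iff_right]
  simp [fun e => upTri_ne_downTri e p]

theorem pathRegion_eq_empty_left (hA : ∀ p ∈ A, X < p.1) : pathRegion X A V = pathRegion X ∅ V := by
  refine ext_upTri_downTri (fun p => ?_) (fun p => ?_)
  · have := hA p
    simp only [upTri_mem_pathRegion, notMem_empty, false_or]
    grind
  · simp only [downTri_mem_pathRegion]

theorem pathRegion_sdiff (hp : left p ∉ V) (he : e ∈ V) :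
    pathRegion X A V \ {upTri p, downTri e} =
      pathRegion X (insert (right e) (A.erase p)) (V.erase e) := by
  refine ext_upTri_downTri (fun p' => ?_) (fun p' => ?_)
  · have hright : p' = right e ↔ left p' = e := by rw [eq_comm, right_eq_iff, eq_comm]
    simp only [mem_sdiff, upTri_mem_pathRegion, mem_insert, mem_singleton,
      upTri_injective.eq_iff, upTri_ne_downTri, or_false, mem_erase, hright]
    grind
  · simp only [mem_sdiff, downTri_mem_pathRegion, mem_insert, mem_singleton,
      downTri_injective.eq_iff, (upTri_ne_downTri _ _).symm, false_or, mem_erase]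
    tauto

theorem pathRegion_empty_sdiff :
    pathRegion X ∅ V \ {upTri (right e), downTri e} = pathRegion X ∅ (V.erase e) := by
  refine ext_upTri_downTri (fun p' => ?_) (fun p' => ?_)
  · have hright : p' = right e ↔ left p' = e := by rw [eq_comm, right_eq_iff, eq_comm]
    simp only [mem_sdiff, upTri_mem_pathRegion, mem_insert, mem_singleton, notMem_empty,
      upTri_injective.eq_iff, upTri_ne_downTri, or_false, false_or, mem_erase, hright]
    tauto
  · simp only [mem_sdiff, downTri_mem_pathRegion, mem_insert, mem_singleton,
      downTri_injective.eq_iff, (upTri_ne_downTri _ _).symm, false_or, mem_erase]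
    tauto

theorem tilingGF_pathRegion_empty (q : K) (hV : ∀ e ∈ V, e.1 < X) :
    tilingGF q (pathRegion X ∅ V) = 1 := by
  induction hn : V.card generalizing V with
  | zero =>
    rw [card_eq_zero.1 hn]
    simp [pathRegion, tilingGF_empty]
  | succ n ih =>
    obtain ⟨e, he, hmin⟩ := V.exists_min_image Prod.fst (card_pos.1 (by omega))
    have hleft (j : ℤ) : upTri (e.1, j) ∉ pathRegion X ∅ V := fun h => by
      have := hmin _ ((upTri_mem_pathRegion.1 h).1.resolve_left (notMem_empty _))
      simp only [left] at this
      omega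
    have hright : upTri (right e) ∈ pathRegion X ∅ V :=
      upTri_mem_pathRegion.2 ⟨Or.inr (by rwa [left_right]), hV e he⟩
    rw [tilingGF_downTri q (downTri_mem_pathRegion.2 he) (hleft e.2) (hleft _) hright,
      pathRegion_empty_sdiff]
    exact ih (fun e' he' => hV e' (mem_of_mem_erase he')) (by rw [card_erase_of_mem he]; omega)

theorem tilingGF_pathRegion_step (q : K) (hp : p ∈ A) (hpX : p.1 ≤ X) (hleft : left p ∉ V) :
    tilingGF q (pathRegion X A V) =
      (if p ∈ V then
        tilingGF q (pathRegion X (insert (right p) (A.erase p)) (V.erase p)) else 0) +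
      verticalWeight q p * if below p ∈ V then
        tilingGF q (pathRegion X (insert (right (below p)) (A.erase p)) (V.erase (below p)))
        else 0 := by
  rw [tilingGF_upTri q (upTri_mem_pathRegion.2 ⟨Or.inl hp, hpX⟩)
    (downTri_mem_pathRegion.not.2 hleft)]
  simp +contextual only [downTri_mem_pathRegion, pathRegion_sdiff hleft]

end PathRegion

section PathWeight

variable {K : Type*} [Field K]

/-- The generating function of the lattice paths from the position `p` to the height `y` in the
strip `X + 1`, each step of which leads to the next strip at the same height, or one unit lower
through a vertical lozenge. -/
noncomputable def pathWeight (q : K) (X y : ℤ) (p : ℤ × ℤ) : K :=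
  if p.1 ≤ X then
    pathWeight q X y (right p) + verticalWeight q p * pathWeight q X y (right (below p))
  else if p.2 = y then 1 else 0
termination_by (X + 1 - p.1).toNat
decreasing_by all_goals simp only [right, below]; omega

theorem pathWeight_of_le (q : K) {X : ℤ} (y : ℤ) {p : ℤ × ℤ} (hp : p.1 ≤ X) :
    pathWeight q X y p =
      pathWeight q X y (right p) + verticalWeight q p * pathWeight q X y (right (below p)) := by
  rw [pathWeight, if_pos hp]

theorem pathWeight_of_lt (q : K) {X : ℤ} (y : ℤ) {p : ℤ × ℤ} (hp : X < p.1) :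
    pathWeight q X y p = if p.2 = y then 1 else 0 := by
  rw [pathWeight, if_neg hp.not_ge]

theorem pathWeight_eq_zero (q : K) {X y : ℤ} {p : ℤ × ℤ} (hpX : p.1 ≤ X + 1)
    (hp : p.2 < y ∨ X + 1 + y < p.1 + p.2) : pathWeight q X y p = 0 := by
  fun_induction pathWeight q X y p with
  | case1 p h ih₁ ih₂ =>
    simp only [right, below] at ih₁ ih₂ ⊢
    rw [ih₁ (by omega) (by omega), ih₂ (by omega) (by omega), mul_zero, add_zero]
  | case2 p h hy => omega
  | case3 => rfl

variable {m : ℕ}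

/-- The matrix of the lattice path generating functions from the positions `a k` to the heights
`0, …, m - 1` in the strip `X + 1`. -/
noncomputable def pathMatrix (q : K) (X : ℤ) (a : Fin m → ℤ × ℤ) : Matrix (Fin m) (Fin m) K :=
  .of fun k y => pathWeight q X y (a k)

theorem pathMatrix_update (q : K) (X : ℤ) (a : Fin m → ℤ × ℤ) (k : Fin m) (p : ℤ × ℤ) :
    pathMatrix q X (Function.update a k p) =
      (pathMatrix q X a).updateRow k fun y => pathWeight q X y p := by
  ext i y
  simp only [pathMatrix, Matrix.of_apply, Matrix.updateRow_apply, Function.update_apply]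
  split_ifs <;> rfl

theorem det_pathMatrix_step (q : K) {X : ℤ} {a : Fin m → ℤ × ℤ} {k : Fin m} (hk : (a k).1 ≤ X) :
    (pathMatrix q X a).det =
      (pathMatrix q X (Function.update a k (right (a k)))).det +
      verticalWeight q (a k) *
        (pathMatrix q X (Function.update a k (right (below (a k))))).det := by
  rw [pathMatrix_update, pathMatrix_update, ← Matrix.det_updateRow_smul,
    ← Matrix.det_updateRow_add]
  congr 1
  refine ((pathMatrix q X a).updateRow_eq_self k).symm.trans (congrArg _ ?_)
  ext y
  exact pathWeight_of_le q y hk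

end PathWeight

section General

theorem image_univ_update {ι α : Type*} [Fintype ι] [DecidableEq ι] [DecidableEq α] {a : ι → α}
    (ha : Function.Injective a) (k : ι) (b : α) :
    univ.image (Function.update a k b) = insert b ((univ.image a).erase (a k)) := by
  ext p
  simp only [mem_image, mem_univ, true_and, mem_insert, mem_erase]
  constructor
  · rintro ⟨i, rfl⟩
    rcases eq_or_ne i k with rfl | hi
    · exact Or.inl (Function.update_self ..)
    · rw [Function.update_of_ne hi]
      exact Or.inr ⟨ha.ne hi, i, rfl⟩
  · rintro (rfl | ⟨hne, i, rfl⟩)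
    · exact ⟨k, Function.update_self ..⟩
    · exact ⟨i, Function.update_of_ne (fun h => hne (congrArg a h)) _ _⟩

theorem eq_coe_of_strictMono {m : ℕ} {h : Fin m → ℤ} (hmono : StrictMono h) (h0 : ∀ k, 0 ≤ h k)
    (hm : ∀ k, h k < m) (k : Fin m) : h k = k := by
  let g : Fin m → Fin m := fun k => ⟨(h k).toNat, by have := hm k; have := h0 k; omega⟩
  have hg : StrictMono g := fun i j hij => by
    have := hmono hij
    have := h0 i
    simp only [g, Fin.mk_lt_mk]
    omega
  have hk := congrArg Fin.val (congrFun (hg.range_inj strictMono_id |>.1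
    (by rw [Set.range_id, (Finite.surjective_of_injective hg.injective).range_eq])) k)
  have := h0 k
  simp only [g, id] at hk
  omega

end General

section Frontier

variable {X : ℤ} {d m : ℕ} {a : Fin m → ℤ × ℤ} {V : Finset (ℤ × ℤ)}

/-- The positions `p` for which `downTri p` lies in the region that is bounded on the left by the
vertical axis and on the right by the lines `p.1 = X + 1` and `p.1 + p.2 = X + m`. -/
def InBounds (X : ℤ) (d m : ℕ) (p : ℤ × ℤ) : Prop :=
  0 ≤ p.2 ∧ p.2 ≤ 2 * d ∧ -1 ≤ 2 * p.1 + p.2 ∧ p.1 + p.2 ≤ X + m - 1 ∧ p.1 ≤ X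

/-- A frontier of a partially tiled region: `a k` is the current position of the `k`-th lattice
path, and `V` is the set of the down-pointing triangles that are not yet covered. -/
structure IsFrontier (X : ℤ) (d : ℕ) {m : ℕ} (a : Fin m → ℤ × ℤ) (V : Finset (ℤ × ℤ)) : Prop where
  inBounds : ∀ e ∈ V, InBounds X d m e
  ordered : ∀ k k', k < k' → (a k).2 ≤ (a k').2 ∧ (a k).1 + (a k).2 < (a k').1 + (a k').2
  position : ∀ k, (a k).1 ≤ X + 1 ∧ 0 ≤ (a k).2 ∧ (a k).2 ≤ 2 * d ∧
    0 ≤ 2 * (a k).1 + (a k).2 ∧ (a k).1 + (a k).2 ≤ X + m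
  left_notMem : ∀ k, left (a k) ∉ V
  missing : ∀ e, InBounds X d m e → e ∉ V → (∃ k, a k = right e) ∨ ∀ k, e.1 < (a k).1

/-- The path `k` is the last one among those that have advanced the least. It can make its next step
without meeting another path. -/
structure IsLastLeftmost (a : Fin m → ℤ × ℤ) (k : Fin m) : Prop where
  le : ∀ k', (a k).1 ≤ (a k').1
  lt : ∀ k', k < k' → (a k).1 < (a k').1

theorem exists_isLastLeftmost [NeZero m] (a : Fin m → ℤ × ℤ) : ∃ k, IsLastLeftmost a k := by
  obtain ⟨k, -, hk⟩ := univ.exists_min_image (fun k => toLex ((a k).1, OrderDual.toDual k))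
    univ_nonempty
  refine ⟨k, fun k' => ?_, fun k' hlt => ?_⟩ <;>
  · have := Prod.Lex.toLex_le_toLex.1 (hk k' (mem_univ _))
    simp only [OrderDual.toDual_le_toDual] at this
    omega

namespace IsFrontier

variable (h : IsFrontier X d a V)
include h

theorem injective : Function.Injective a := by
  refine Function.Injective.of_comp (f := fun p : ℤ × ℤ => p.1 + p.2)
    (StrictMono.injective fun k k' hk => (h.ordered k k' hk).2)

section Step

variable {k : Fin m} (hk : IsLastLeftmost a k) {e : ℤ × ℤ}
include hk

theorem ordered_update (he : e ∈ V) (hstep : e = a k ∨ e = below (a k)) (i i' : Fin m)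
    (hi : i < i') : (Function.update a k (right e) i).2 ≤ (Function.update a k (right e) i').2 ∧
      (Function.update a k (right e) i).1 + (Function.update a k (right e) i).2 <
        (Function.update a k (right e) i').1 + (Function.update a k (right e) i').2 := by
  have hord := h.ordered i i' hi
  have hfree : left (a i') ≠ e := fun hc => h.left_notMem i' (hc ▸ he)
  have hmin := hk.le i
  simp only [below, left, right, Function.update_apply, Prod.ext_iff, ne_eq] at hstep hfree ⊢
  split_ifs with hik hik' hik'
  · omega
  · subst hik
    have := hk.lt i' hi
    omega
  · subst hik'
    dsimp only
    omega
  · exact hord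

theorem missing_update (hstep : e = a k ∨ e = below (a k)) (e' : ℤ × ℤ) (he' : InBounds X d m e')
    (hmem : e' ∉ V.erase e) : (∃ i, Function.update a k (right e) i = right e') ∨
      ∀ i, e'.1 < (Function.update a k (right e) i).1 := by
  rcases eq_or_ne e' e with rfl | hne
  · exact Or.inl ⟨k, Function.update_self ..⟩
  have hle (i : Fin m) : (a i).1 ≤ (Function.update a k (right e) i).1 := by
    simp only [below, right, Function.update_apply, Prod.ext_iff] at hstep ⊢
    split_ifs with hi
    · subst hi
      dsimp only
      omega
    · exact le_rfl
  rcases h.missing e' he' (fun hV => hmem (mem_erase.2 ⟨hne, hV⟩)) with ⟨i, hi⟩ | hlt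
  · rcases eq_or_ne i k with rfl | hik
    · have hi₁ : (a i).1 = e'.1 + 1 := congrArg Prod.fst hi
      refine Or.inr fun i' => ?_
      have := hk.le i'
      have := hle i'
      omega
    · exact Or.inl ⟨i, by rw [Function.update_of_ne hik, hi]⟩
  · exact Or.inr fun i => (hlt i).trans_le (hle i)

theorem step (he : e ∈ V) (hstep : e = a k ∨ e = below (a k)) :
    IsFrontier X d (Function.update a k (right e)) (V.erase e) where
  inBounds e' he' := h.inBounds e' (mem_of_mem_erase he')
  ordered := h.ordered_update hk he hstep
  position i := by
    have hpos := h.position i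
    obtain ⟨_, _, _, _, _⟩ := h.inBounds e he
    simp only [right, Function.update_apply]
    split_ifs with hi
    · simp only [below, Prod.ext_iff] at hstep
      subst hi
      omega
    · exact hpos
  left_notMem i := by
    rw [Function.update_apply]
    split_ifs with hi
    · rw [left_right]
      exact notMem_erase _ _
    · exact fun hV => h.left_notMem i (mem_of_mem_erase hV)
  missing := h.missing_update hk hstep

end Step

variable {K : Type*} [Field K] (q : K)

theorem det_pathMatrix_update_eq_zero {k : Fin m} (hkX : (a k).1 ≤ X) {e : ℤ × ℤ} (he : e ∉ V)
    (hstep : e = a k ∨ e = below (a k)) :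
    (pathMatrix q X (Function.update a k (right e))).det = 0 := by
  have he₁ : e.1 = (a k).1 := by rcases hstep with rfl | rfl <;> rfl
  by_cases hin : InBounds X d m e
  · rcases h.missing e hin he with ⟨k', hk'⟩ | hlt
    · have hne : k ≠ k' := by
        rintro rfl
        have := congrArg Prod.fst hk'
        simp only [right] at this
        omega
      refine Matrix.det_zero_of_row_eq hne ?_
      ext y
      simp only [pathMatrix, Matrix.of_apply, Function.update_self,
        Function.update_of_ne hne.symm, hk']
    · exact absurd (hlt k) he₁.not_lt
  · refine Matrix.det_eq_zero_of_row_eq_zero k fun y => ?_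
    have := h.position k
    simp only [InBounds, below, Prod.ext_iff] at hin hstep
    simp only [pathMatrix, Matrix.of_apply, Function.update_self]
    refine pathWeight_eq_zero q ?_ ?_ <;> simp only [right] <;> omega

theorem height_eq_of_finished (hend : ∀ k, (a k).1 = X + 1) (k : Fin m) : (a k).2 = k := by
  refine eq_coe_of_strictMono (h := fun k => (a k).2) (fun i j hij => ?_)
    (fun k => (h.position k).2.1) (fun k => ?_) k
  · have := (h.ordered i j hij).2
    rw [hend i, hend j] at this
    dsimp only
    omega
  · have := (h.position k).2.2.2.2
    rw [hend k] at this
    omega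

theorem pathMatrix_eq_one_of_finished (hend : ∀ k, (a k).1 = X + 1) : pathMatrix q X a = 1 := by
  ext k y
  rw [pathMatrix, Matrix.of_apply, pathWeight_of_lt q _ (by rw [hend k]; omega),
    h.height_eq_of_finished hend k, Matrix.one_apply]
  simp only [Nat.cast_inj, Fin.ext_iff]

theorem tilingGF_eq_one_of_finished (hend : ∀ k, (a k).1 = X + 1) :
    tilingGF q (pathRegion X (univ.image a) V) = 1 := by
  have hA : ∀ p ∈ univ.image a, X < p.1 := fun p hp => by
    obtain ⟨k, -, rfl⟩ := mem_image.1 hp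
    rw [hend k]
    omega
  rw [pathRegion_eq_empty_left hA]
  refine tilingGF_pathRegion_empty q fun e he => ?_
  obtain ⟨_, _, _, _, hX⟩ := h.inBounds e he
  refine lt_of_le_of_ne hX fun heX => ?_
  let k : Fin m := ⟨e.2.toNat, by omega⟩
  have hk : left (a k) = e := by
    have := h.height_eq_of_finished hend k
    simp only [left, Prod.ext_iff, hend k, this, k]
    omega
  exact h.left_notMem k (hk ▸ he)

theorem tilingGF_eq_det : tilingGF q (pathRegion X (univ.image a) V) = (pathMatrix q X a).det := by
  induction hn : ∑ k, (X + 1 - (a k).1).toNat using Nat.strong_induction_on generalizing a V with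
  | _ n ih
  subst hn
  by_cases hend : ∀ k, (a k).1 = X + 1
  · rw [h.tilingGF_eq_one_of_finished q hend, h.pathMatrix_eq_one_of_finished q hend,
      Matrix.det_one]
  obtain ⟨k₀, hk₀⟩ := not_forall.1 hend
  have : NeZero m := ⟨by have := k₀.2; omega⟩
  obtain ⟨k, hk⟩ := exists_isLastLeftmost a
  have hkX : (a k).1 ≤ X := by
    have := hk.le k₀
    have := (h.position k₀).1
    omega
  have hnext {e : ℤ × ℤ} (hstep : e = a k ∨ e = below (a k)) :
      (if e ∈ V then tilingGF q (pathRegion X (insert (right e) ((univ.image a).erase (a k)))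
        (V.erase e)) else 0) = (pathMatrix q X (Function.update a k (right e))).det := by
    split_ifs with he
    · rw [← image_univ_update h.injective]
      refine ih _ ?_ (h.step hk he hstep) rfl
      have he₁ : e.1 = (a k).1 := by rcases hstep with rfl | rfl <;> rfl
      refine sum_lt_sum (fun i _ => ?_) ⟨k, mem_univ _, ?_⟩
      · rcases eq_or_ne i k with rfl | hi
        · simp only [Function.update_self, right]
          omega
        · rw [Function.update_of_ne hi]
      · simp only [Function.update_self, right]
        omega
    · exact (h.det_pathMatrix_update_eq_zero q hkX he hstep).symm
  rw [tilingGF_pathRegion_step q (mem_image_of_mem a (mem_univ k)) hkX (h.left_notMem k),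
    hnext (Or.inl rfl), hnext (Or.inr rfl), ← det_pathMatrix_step q hkX]

end IsFrontier

end Frontier

section IntervalProducts

variable {M : Type*} [CommMonoid M]

theorem prod_Ioc_mul_prod_Ioc {α : Type*} [LinearOrder α] [LocallyFiniteOrder α] (f : α → M)
    {a b c : α} (hab : a ≤ b) (hbc : b ≤ c) :
    (∏ t ∈ Ioc a b, f t) * ∏ t ∈ Ioc b c, f t = ∏ t ∈ Ioc a c, f t := by
  rw [← Ioc_union_Ioc_eq_Ioc hab hbc, prod_union (Ioc_disjoint_Ioc_of_le le_rfl)]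

theorem prod_Ioc_mul_prod_Ioc_comm {α : Type*} [LinearOrder α] [LocallyFiniteOrder α] (f : α → M)
    {a b c d : α} (hac : a ≤ c) (had : a ≤ d) (hbc : b ≤ c) (hbd : b ≤ d) :
    (∏ t ∈ Ioc a c, f t) * ∏ t ∈ Ioc b d, f t =
      (∏ t ∈ Ioc b c, f t) * ∏ t ∈ Ioc a d, f t := by
  wlog hab : a ≤ b generalizing a b
  · exact (this hbc hbd hac had (le_of_not_ge hab)).symm
  rw [← prod_Ioc_mul_prod_Ioc f hab hbc, ← prod_Ioc_mul_prod_Ioc f hab hbd, mul_assoc,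
    mul_left_comm]

theorem prod_range_sub (f : ℤ → M) (b : ℤ) (n : ℕ) :
    ∏ u ∈ range n, f (b - u) = ∏ t ∈ Ioc (b - n) b, f t :=
  prod_nbij' (fun u => b - u) (fun t => (b - t).toNat)
    (fun u hu => by simp only [mem_range, mem_Ioc] at *; omega)
    (fun t ht => by simp only [mem_range, mem_Ioc] at *; omega)
    (fun u _ => by simp only [sub_sub_cancel, Int.toNat_natCast])
    (fun t ht => by simp only [mem_Ioc] at ht; omega) (fun _ _ => rfl)

theorem prod_Ico_add (f : ℤ → M) (b : ℤ) (m n : ℕ) :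
    ∏ u ∈ Ico m n, f (b + u) = ∏ t ∈ Ioc (b + m - 1) (b + n - 1), f t :=
  prod_nbij' (fun u => b + u) (fun t => (t - b).toNat)
    (fun u hu => by simp only [mem_Ico, mem_Ioc] at *; omega)
    (fun t ht => by simp only [mem_Ico, mem_Ioc] at *; omega)
    (fun u _ => by simp only [add_sub_cancel_left, Int.toNat_natCast])
    (fun t ht => by simp only [mem_Ioc] at ht; omega) (fun _ _ => rfl)

theorem prod_Icc_one_add (f : ℤ → M) (b n : ℤ) :
    ∏ j ∈ Icc 1 n, f (b + j) = ∏ t ∈ Ioc b (b + n), f t :=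
  prod_nbij' (fun j => b + j) (fun t => t - b)
    (fun j hj => by simp only [mem_Icc, mem_Ioc] at *; omega)
    (fun t ht => by simp only [mem_Icc, mem_Ioc] at *; omega)
    (fun j _ => by simp only [add_sub_cancel_left])
    (fun t _ => by simp only [add_sub_cancel]) (fun _ _ => rfl)

theorem prod_Icc_one_sub (f : ℤ → M) (b n : ℤ) :
    ∏ j ∈ Icc 1 n, f (b + 1 - j) = ∏ t ∈ Ioc (b - n) b, f t :=
  prod_nbij' (fun j => b + 1 - j) (fun t => b + 1 - t)
    (fun j hj => by simp only [mem_Icc, mem_Ioc] at *; omega)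
    (fun t ht => by simp only [mem_Icc, mem_Ioc] at *; omega)
    (fun j _ => by simp only [sub_sub_cancel])
    (fun t _ => by simp only [sub_sub_cancel]) (fun _ _ => rfl)

theorem prod_Ioc_add_one (f : ℤ → M) {a b : ℤ} (hab : a ≤ b) :
    ∏ t ∈ Ioc a (b + 1), f t = (∏ t ∈ Ioc a b, f t) * f (b + 1) := by
  rw [← prod_Ioc_mul_prod_Ioc f hab (show b ≤ b + 1 by omega),
    show Ioc b (b + 1) = {b + 1} by ext t; simp only [mem_Ioc, mem_singleton]; omega,
    prod_singleton]

theorem prod_Ioc_sub_one (f : ℤ → M) {a b : ℤ} (hab : a ≤ b) :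
    ∏ t ∈ Ioc (a - 1) b, f t = f a * ∏ t ∈ Ioc a b, f t := by
  rw [← prod_Ioc_mul_prod_Ioc f (show a - 1 ≤ a by omega) hab,
    show Ioc (a - 1) a = {a} by ext t; simp only [mem_Ioc, mem_singleton]; omega, prod_singleton]

end IntervalProducts

section SymInt

variable {K : Type*} [Field K]

/-- The symmetric `q`-integer `q^(n-1) + q^(n-3) + ⋯ + q^(1-n)`, as a quotient in order to be
defined for every integer `n`; it is `q^(1-n) [n]_{q²}` for `0 ≤ n`. -/
noncomputable def symInt (q : K) (n : ℤ) : K := (q ^ n - q ^ (-n)) / (q - q⁻¹)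

theorem symInt_zero (q : K) : symInt q 0 = 0 := by
  simp [symInt]

theorem symInt_add_eq {q : K} (hq : q ≠ 0) (h2 : (2 : K) ≠ 0) (a b j : ℤ) :
    symInt q (a + b) = symInt q (a - b) + 2 * symInt q b * wt₁ q a j := by
  have ha : q ^ a ≠ 0 := zpow_ne_zero a hq
  have hb : q ^ b ≠ 0 := zpow_ne_zero b hq
  simp only [symInt, wt₁, neg_add, neg_sub, zpow_add₀ hq, zpow_sub₀ hq, zpow_neg]
  field_simp
  ring

theorem zpow_ne_one_of_pos {q : K} (hfin : ¬ IsOfFinOrder q) {n : ℤ} (hn : 0 < n) : q ^ n ≠ 1 := by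
  lift n to ℕ using hn.le
  rw [zpow_natCast]
  exact fun h => hfin (isOfFinOrder_iff_pow_eq_one.2 ⟨n, by exact_mod_cast hn, h⟩)

theorem zpow_sub_zpow_neg_ne_zero {q : K} (hq : q ≠ 0) (hfin : ¬ IsOfFinOrder q) {n : ℤ}
    (hn : 0 < n) : q ^ n - q ^ (-n) ≠ 0 := fun h => by
  refine zpow_ne_one_of_pos hfin (show 0 < n + n by omega) ?_
  rw [zpow_add₀ hq]
  nth_rw 2 [sub_eq_zero.1 h]
  rw [← zpow_add₀ hq, add_neg_cancel, zpow_zero]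

theorem sub_inv_ne_zero {q : K} (hq : q ≠ 0) (hfin : ¬ IsOfFinOrder q) : q - q⁻¹ ≠ 0 := by
  simpa using zpow_sub_zpow_neg_ne_zero hq hfin one_pos

theorem symInt_ne_zero {q : K} (hq : q ≠ 0) (hfin : ¬ IsOfFinOrder q) {n : ℤ} (hn : 0 < n) :
    symInt q n ≠ 0 :=
  div_ne_zero (zpow_sub_zpow_neg_ne_zero hq hfin hn) (sub_inv_ne_zero hq hfin)

theorem qInt_sq_eq_zpow_mul_symInt {q : K} (hq : q ≠ 0) (hfin : ¬ IsOfFinOrder q) {n : ℤ}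
    (hn : 0 ≤ n) : qInt (q ^ 2) n = q ^ (n - 1) * symInt q n := by
  lift n to ℕ using hn
  have hsq : q ^ 2 ≠ 1 := by exact_mod_cast zpow_ne_one_of_pos hfin (n := 2) (by norm_num)
  have hsq' : q ^ 2 - 1 ≠ 0 := sub_ne_zero.2 hsq
  rw [qInt, Int.toNat_natCast, geom_sum_eq hsq, symInt, zpow_sub_one₀ hq, zpow_neg, zpow_natCast]
  field_simp
  ring

/-- The factorial `⟦s⟧⟦2s⟧⋯⟦ns⟧` of symmetric `q`-integers; it occurs with `s = 1` and `s = 2`. -/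
noncomputable def symFact (q : K) (s n : ℤ) : K := ∏ t ∈ Ioc 0 n, symInt q (s * t)

theorem symFact_ne_zero {q : K} (hq : q ≠ 0) (hfin : ¬ IsOfFinOrder q) {s : ℤ} (hs : 0 < s)
    (n : ℤ) : symFact q s n ≠ 0 :=
  prod_ne_zero_iff.2 fun _ ht => symInt_ne_zero hq hfin (mul_pos hs (mem_Ioc.1 ht).1)

theorem symFact_mul_prod_Ioc (q : K) (s : ℤ) {a b : ℤ} (ha : 0 ≤ a) (hab : a ≤ b) :
    symFact q s a * ∏ t ∈ Ioc a b, symInt q (s * t) = symFact q s b :=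
  prod_Ioc_mul_prod_Ioc _ ha hab

theorem prod_Ioc_symInt_eq_div {q : K} (hq : q ≠ 0) (hfin : ¬ IsOfFinOrder q) {s a b : ℤ}
    (hs : 0 < s) (ha : 0 ≤ a) (hab : a ≤ b) :
    ∏ t ∈ Ioc a b, symInt q (s * t) = symFact q s b / symFact q s a := by
  rw [eq_div_iff (symFact_ne_zero hq hfin hs a), mul_comm, symFact_mul_prod_Ioc q s ha hab]

end SymInt

section Determinant

theorem exists_coeff_prod_linear {R ι : Type*} [CommRing R] (s : Finset ι) (α β : ι → R) :
    ∃ c : ℕ → R, ∀ v w : R, ∏ u ∈ s, (v * α u + w * β u) =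
      ∑ j ∈ range (#s + 1), v ^ j * w ^ (#s - j) * c j := by
  classical
  refine ⟨fun j => ∑ t ∈ powersetCard j s, (∏ u ∈ t, α u) * ∏ u ∈ s \ t, β u, fun v w => ?_⟩
  rw [prod_add, sum_powerset]
  refine sum_congr rfl fun j _ => ?_
  rw [mul_sum]
  refine sum_congr rfl fun t ht => ?_
  obtain ⟨hts, rfl⟩ := mem_powersetCard.1 ht
  rw [prod_mul_distrib, prod_mul_distrib, prod_const, prod_const, card_sdiff_of_subset hts]
  ring

/-- The determinant of two vectors of the plane. -/
def wedge {R : Type*} [CommRing R] (p p' : R × R) : R := p.1 * p'.2 - p'.1 * p.2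

/-- The homogeneous polynomials of degree `m - 1` in `p` that form the columns of Krattenthaler's
determinant. -/
def wedgeProd {R : Type*} [CommRing R] (A B : ℕ → R × R) (m y : ℕ) (p : R × R) : R :=
  (∏ u ∈ range y, wedge p (B u)) * ∏ u ∈ Ico y (m - 1), wedge (A u) p

theorem wedgeProd_eq_zero {R : Type*} [CommRing R] (A B : ℕ → R × R) (m : ℕ) {y k : ℕ}
    (hk : k < y) : wedgeProd A B m y (B k) = 0 := by
  rw [wedgeProd, prod_eq_zero (mem_range.2 hk) (sub_self _), zero_mul]

theorem exists_wedgeProd_matrix_eq {R : Type*} [CommRing R] (A B : ℕ → R × R) (m : ℕ) :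
    ∃ C : Matrix (Fin m) (Fin m) R, ∀ P : Fin m → R × R,
      (.of fun k y : Fin m => wedgeProd A B m y (P k)) =
        Matrix.projVandermonde (fun k => (P k).1) (fun k => (P k).2) * C := by
  choose c hc using fun y : Fin m => exists_coeff_prod_linear (range (m - 1))
    (fun u => if u < y then (B u).2 else -(A u).2) (fun u => if u < y then -(B u).1 else (A u).1)
  refine ⟨.of fun j y => c y j, fun P => ?_⟩
  ext k y
  have hcard : m - 1 + 1 = m := by have := y.2; omega
  have hfactors : wedgeProd A B m y (P k) = ∏ u ∈ range (m - 1),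
      ((P k).1 * (if u < y then (B u).2 else -(A u).2) +
        (P k).2 * if u < y then -(B u).1 else (A u).1) := by
    rw [wedgeProd, ← prod_range_mul_prod_Ico _ (show (y : ℕ) ≤ m - 1 by omega)]
    congr 1 <;> refine prod_congr rfl fun u hu => ?_
    · rw [if_pos (mem_range.1 hu), if_pos (mem_range.1 hu), wedge]
      ring
    · rw [if_neg (mem_Ico.1 hu).1.not_gt, if_neg (mem_Ico.1 hu).1.not_gt, wedge]
      ring
  rw [Matrix.of_apply, hfactors, hc, card_range, hcard, Matrix.mul_apply,
    ← Fin.sum_univ_eq_sum_range fun j => (P k).1 ^ j * (P k).2 ^ (m - 1 - j) * c y j]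
  simp only [Matrix.projVandermonde_apply, Matrix.of_apply, Fin.val_rev, Nat.sub_sub, add_comm 1]

theorem prod_prod_range_eq_prod_prod_Ioi {M : Type*} [CommMonoid M] {m : ℕ} (f : ℕ → ℕ → M) :
    ∏ k : Fin m, ∏ u ∈ range k, f k u = ∏ i : Fin m, ∏ j ∈ Ioi i, f j i := by
  have hrange (k : Fin m) : ∏ u ∈ range k, f k u = ∏ i ∈ Iio k, f k i := by
    rw [← Nat.Iio_eq_range, ← Fin.map_valEmbedding_Iio, prod_map]
    rfl
  simp only [hrange]
  exact prod_comm' (by simp)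

/-- Up to a factor that does not depend on `P`, the determinant is the homogeneous Vandermonde
determinant of the points `P k`; the factor is found by evaluating at the points `B k`, where the
matrix is triangular. -/
theorem det_wedgeProd {R : Type*} [CommRing R] [IsDomain R] (A : ℕ → R × R) {B : ℕ → R × R} {m : ℕ}
    (hB : ∀ i j, i < j → j < m → wedge (B j) (B i) ≠ 0) (P : Fin m → R × R) :
    (Matrix.of fun k y : Fin m => wedgeProd A B m y (P k)).det =
      (∏ i, ∏ j ∈ Ioi i, wedge (P j) (P i)) *
        ∏ k : Fin m, ∏ u ∈ Ico (k : ℕ) (m - 1), wedge (A u) (B k) := by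
  obtain ⟨C, hC⟩ := exists_wedgeProd_matrix_eq A B m
  have hdet (P : Fin m → R × R) : (Matrix.of fun k y : Fin m => wedgeProd A B m y (P k)).det =
      (∏ i, ∏ j ∈ Ioi i, wedge (P j) (P i)) * C.det := by
    rw [hC, Matrix.det_mul, Matrix.det_projVandermonde]
    rfl
  have htriangular : (Matrix.of fun k y : Fin m => wedgeProd A B m y (B k)).det =
      (∏ i : Fin m, ∏ j ∈ Ioi i, wedge (B j) (B i)) *
        ∏ k : Fin m, ∏ u ∈ Ico (k : ℕ) (m - 1), wedge (A u) (B k) := by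
    have hzero : (Matrix.of fun k y : Fin m => wedgeProd A B m y (B k)).IsLowerTriangular :=
      fun _ _ hky => wedgeProd_eq_zero A B m (OrderDual.toDual_lt_toDual.1 hky)
    rw [Matrix.det_of_isLowerTriangular _ hzero,
      ← prod_prod_range_eq_prod_prod_Ioi fun j i => wedge (B j) (B i), ← prod_mul_distrib]
    rfl
  have hne : ∏ i : Fin m, ∏ j ∈ Ioi i, wedge (B j) (B i) ≠ 0 :=
    prod_ne_zero_iff.2 fun i _ => prod_ne_zero_iff.2 fun j hj =>
      hB i j (Fin.lt_def.1 (mem_Ioi.1 hj)) j.2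
  rw [hdet P, mul_left_cancel₀ hne ((hdet fun k => B k).symm.trans htriangular)]

end Determinant

section StartWeight

variable {K : Type*} [Field K] {q : K}

/-- The generating function of the lattice paths with `n` steps, `k` of them descending, that start
on the vertical axis; it does not depend on the starting point. -/
noncomputable def startWeight (q : K) (n : ℤ) (k : ℕ) : K :=
  (∏ s ∈ Ioc (n - k) n, symInt q (2 * s)) / (2 ^ k * symFact q 1 k)

theorem startWeight_zero_right (q : K) (n : ℤ) : startWeight q n 0 = 1 := by
  simp [startWeight, symFact]

theorem startWeight_eq_zero (q : K) {n k : ℕ} (hnk : n < k) : startWeight q n k = 0 := by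
  rw [startWeight, prod_eq_zero (mem_Ioc.2 ⟨by omega, by omega⟩ : (0 : ℤ) ∈ Ioc _ _), zero_div]
  rw [mul_zero, symInt_zero]

theorem startWeight_succ (hq : q ≠ 0) (h2 : (2 : K) ≠ 0) (hfin : ¬ IsOfFinOrder q) (n : ℤ)
    (k : ℕ) (j : ℤ) : startWeight q (n + 1) (k + 1) =
      startWeight q n (k + 1) + wt₁ q (2 * n + 1 - k) j * startWeight q n k := by
  have htop : ∏ s ∈ Ioc (n - k) (n + 1), symInt q (2 * s) =
      (∏ s ∈ Ioc (n - k) n, symInt q (2 * s)) * symInt q (2 * n + 1 - k + (k + 1)) := by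
    rw [prod_Ioc_add_one _ (by omega)]
    ring_nf
  have hbottom : ∏ s ∈ Ioc (n - k - 1) n, symInt q (2 * s) =
      symInt q (2 * n + 1 - k - (k + 1)) * ∏ s ∈ Ioc (n - k) n, symInt q (2 * s) := by
    rw [prod_Ioc_sub_one _ (by omega)]
    ring_nf
  have hfact : symFact q 1 (k + 1) = symFact q 1 k * symInt q (k + 1) := by
    rw [symFact, prod_Ioc_add_one _ (by omega), one_mul, symFact]
  have hk : symInt q (k + 1) ≠ 0 := symInt_ne_zero hq hfin (by omega)
  have hk' : symFact q 1 k ≠ 0 := symFact_ne_zero hq hfin one_pos k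
  rw [startWeight, startWeight, startWeight, Nat.cast_add_one, add_sub_add_right_eq_sub,
    ← sub_sub, htop, hbottom, hfact, symInt_add_eq hq h2 _ _ j]
  field_simp
  ring

theorem pathWeight_eq_sum_startWeight (hq : q ≠ 0) (h2 : (2 : K) ≠ 0) (hfin : ¬ IsOfFinOrder q)
    {X l : ℤ} (y : ℤ) {n : ℕ} (hn : n ≤ X + 1 + l) :
    pathWeight q X y (-l, 2 * l) =
      ∑ k ∈ range (n + 1), startWeight q n k * pathWeight q X y (n - l, 2 * l - k) := by
  induction n with
  | zero => simp [startWeight_zero_right]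
  | succ n ih =>
    set w : ℕ → K := fun k => pathWeight q X y (n + 1 - l, 2 * l - k) with hw
    have hstep (k : ℕ) : pathWeight q X y (n - l, 2 * l - k) =
        w k + wt₁ q (2 * n + 1 - k) (2 * l - k) * w (k + 1) := by
      rw [pathWeight_of_le q y (by push_cast at hn; simp only; omega), verticalWeight]
      simp only [right, below, hw]
      push_cast
      ring_nf
    calc pathWeight q X y (-l, 2 * l)
      _ = ∑ k ∈ range (n + 1), (startWeight q n k * w k +
            wt₁ q (2 * n + 1 - k) (2 * l - k) * startWeight q n k * w (k + 1)) := by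
        rw [ih (by push_cast at hn; omega)]
        refine sum_congr rfl fun k _ => ?_
        rw [hstep]
        ring
      _ = ∑ k ∈ range (n + 2), startWeight q n k * w k + ∑ k ∈ range (n + 1),
            wt₁ q (2 * n + 1 - k) (2 * l - k) * startWeight q n k * w (k + 1) := by
        rw [sum_add_distrib, sum_range_succ _ (n + 1), startWeight_eq_zero q (Nat.lt_succ_self n),
          zero_mul, add_zero]
      _ = ∑ k ∈ range (n + 2), startWeight q (n + 1) k * w k := by
        rw [sum_range_succ' _ (n + 1), sum_range_succ' _ (n + 1), startWeight_zero_right,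
          startWeight_zero_right, add_right_comm, ← sum_add_distrib]
        congr 1
        refine sum_congr rfl fun k _ => ?_
        rw [startWeight_succ hq h2 hfin n k (2 * l - k)]
        ring
      _ = _ := by simp only [hw, Nat.cast_add_one]

theorem pathWeight_eq_startWeight (hq : q ≠ 0) (h2 : (2 : K) ≠ 0) (hfin : ¬ IsOfFinOrder q)
    (X l y : ℕ) : pathWeight q X y (-l, 2 * l) =
      if y ≤ 2 * l then startWeight q (X + 1 + l) (2 * l - y) else 0 := by
  have hsum := pathWeight_eq_sum_startWeight hq h2 hfin (X := X) (l := l) y (n := X + 1 + l)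
    (by push_cast; rfl)
  have hend (k : ℕ) : pathWeight q X y (((X + 1 + l : ℕ) : ℤ) - l, 2 * (l : ℤ) - k) =
      if k + y = 2 * l then 1 else 0 := by
    rw [pathWeight_of_lt q y (by push_cast; omega)]
    exact if_congr (by omega) rfl rfl
  simp only [hend, mul_ite, mul_one, mul_zero] at hsum
  rw [hsum]
  split_ifs with hy
  · rw [sum_congr rfl fun k _ => if_congr (show k + y = 2 * l ↔ k = 2 * l - y by omega) rfl rfl,
      sum_ite_eq' (range _)]
    split_ifs with hk
    · push_cast
      rfl
    · have := startWeight_eq_zero q (n := X + 1 + l) (k := 2 * l - y)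
        (by simp only [mem_range] at hk; omega)
      push_cast at this
      exact this.symm
  · exact sum_eq_zero fun k _ => if_neg (by omega)

/-- The factor of the path weights from `(-l, 2l)` that does not depend on the final height. -/
noncomputable def rowFactor (q : K) (X m l : ℕ) : K :=
  symFact q 2 (X + 1 + l) / (symFact q 2 (X + m - l) * symFact q 1 (2 * l) * 2 ^ (2 * l))

theorem pathWeight_eq_rowFactor_mul (hq : q ≠ 0) (h2 : (2 : K) ≠ 0) (hfin : ¬ IsOfFinOrder q)
    {X m l y : ℕ} (hl : l ≤ X + m) (hy : y < m) :
    pathWeight q X y (-l, 2 * l) = rowFactor q X m l * (2 ^ y *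
      ((∏ u ∈ range y, symInt q (2 * l - u)) *
        ∏ u ∈ Ico y (m - 1), symInt q (2 * (X + 2 + u) - 2 * l))) := by
  have hfact_ne {s : ℤ} (hs : 0 < s) (n : ℤ) : symFact q s n ≠ 0 := symFact_ne_zero hq hfin hs n
  rw [pathWeight_eq_startWeight hq h2 hfin]
  split_ifs with hyl
  · have hfirst : symFact q 1 (2 * l - y) * ∏ u ∈ range y, symInt q (2 * l - u) =
        symFact q 1 (2 * l) := by
      rw [prod_range_sub, ← symFact_mul_prod_Ioc q 1 (show (0 : ℤ) ≤ 2 * l - y by omega)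
        (show 2 * (l : ℤ) - y ≤ 2 * l by omega)]
      simp only [one_mul]
    have hlast : (∏ t ∈ Ioc ((X : ℤ) + 1 + l - (2 * l - y)) (X + 1 + l), symInt q (2 * t)) *
        symFact q 2 (X + m - l) = symFact q 2 (X + 1 + l) *
          ∏ u ∈ Ico y (m - 1), symInt q (2 * (X + 2 + u) - 2 * l) := by
      rw [symFact, prod_Ioc_mul_prod_Ioc_comm _ (by omega) (by omega) (by omega) (by omega),
        ← symFact]
      congr 1
      convert (prod_Ico_add (fun t => symInt q (2 * t)) (X + 2 - l) y (m - 1)).symm using 2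
      · congr 1 <;> omega
      · ring_nf
    have hpow : (2 : K) ^ (2 * l) = 2 ^ (2 * l - y) * 2 ^ y := by
      rw [← pow_add, Nat.sub_add_cancel hyl]
    rw [startWeight, rowFactor, div_mul_eq_mul_div, div_eq_div_iff, ← hfirst, hpow]
    · push_cast [hyl]
      linear_combination 2 ^ (2 * l - y) * 2 ^ y * symFact q 1 (2 * l - y) *
        (∏ u ∈ range y, symInt q (2 * l - u)) * hlast
    · simp [h2, hfact_ne]
    · simp [h2, hfact_ne]
  · rw [prod_eq_zero (mem_range.2 (not_le.1 hyl)) (by simp [symInt_zero]), zero_mul, mul_zero,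
      mul_zero]

end StartWeight

section RegionB

variable {x d m X : ℕ} {l : Fin m → ℕ}

/-- The set of all positions that satisfy `InBounds`. -/
noncomputable def boundedPositions (X : ℤ) (d m : ℕ) : Finset (ℤ × ℤ) :=
  open scoped Classical in (Icc (-(d : ℤ) - 1) X ×ˢ Icc (0 : ℤ) (2 * d)).filter (InBounds X d m)

theorem mem_boundedPositions {X : ℤ} {d m : ℕ} {p : ℤ × ℤ} :
    p ∈ boundedPositions X d m ↔ InBounds X d m p := by
  simp only [boundedPositions, mem_filter, mem_product, mem_Icc, and_iff_right_iff_imp]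
  rintro ⟨_, _, _, _, _⟩
  omega

/-- The starting positions of the lattice paths: `upTri (start l k)` is the up-pointing unit
triangle in the `l k`-th bump. -/
def start (l : Fin m → ℕ) (k : Fin m) : ℤ × ℤ := (-l k, 2 * l k)

theorem west_eq (y : ℤ) : west y = if y = 0 then 2 else if y % 2 = 0 then 0 else 1 := by
  simp only [west, Int.even_iff]

theorem upTri_mem_fullRegion (hX : X + m = x + d) {p : ℤ × ℤ} :
    upTri p ∈ fullRegion x d m ↔ 0 ≤ p.2 ∧ p.2 ≤ 2 * d ∧ 0 ≤ 2 * p.1 + p.2 ∧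
      p.1 + p.2 ≤ X + m ∧ p.1 ≤ X ∧ (p.2 = 0 → 1 ≤ p.1) := by
  rw [mem_fullRegion, verts, if_pos (odd_upTri p)]
  simp only [forall_mem_insert, mem_singleton, forall_eq, east, le_min_iff, west_eq, upTri]
  split_ifs <;> omega

theorem downTri_mem_fullRegion (hX : X + m = x + d) {p : ℤ × ℤ} :
    downTri p ∈ fullRegion x d m ↔ InBounds X d m p := by
  rw [mem_fullRegion, verts, if_neg (not_odd_downTri p)]
  simp only [forall_mem_insert, mem_singleton, forall_eq, east, le_min_iff, west_eq, downTri,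
    InBounds]
  split_ifs <;> omega

theorem upTri_mem_dents {p : ℤ × ℤ} : upTri p ∈ dents d l ↔
    2 * p.1 + p.2 = 0 ∧ 2 ≤ p.2 ∧ p.2 ≤ 2 * d ∧ p ∉ univ.image (start l) := by
  simp only [dents, start, mem_image, mem_sdiff, mem_Icc, mem_univ, true_and, upTri, Prod.ext_iff]
  constructor
  · rintro ⟨k, ⟨hk, hkl⟩, h1, h2⟩
    refine ⟨by omega, by omega, by omega, fun ⟨i, hi⟩ => hkl ⟨i, by omega⟩⟩
  · rintro ⟨h1, h2, h3, hp⟩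
    refine ⟨p.2.toNat / 2, ⟨by omega, fun ⟨i, hi⟩ => hp ⟨i, by omega⟩⟩, by omega, by omega⟩

theorem downTri_notMem_dents (p : ℤ × ℤ) : downTri p ∉ dents d l := by
  simp only [dents, mem_image, downTri, Prod.ext_iff, not_exists, not_and]
  omega

theorem bounds_of_mem_image_start (hl : ∀ i, 1 ≤ l i ∧ l i ≤ d) {p : ℤ × ℤ}
    (hp : p ∈ univ.image (start l)) : 2 * p.1 + p.2 = 0 ∧ 2 ≤ p.2 ∧ p.2 ≤ 2 * d := by
  obtain ⟨k, -, rfl⟩ := mem_image.1 hp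
  have := hl k
  simp only [start]
  omega

theorem regionB_eq_pathRegion (hX : X + m = x + d) (hl : ∀ i, 1 ≤ l i ∧ l i ≤ d) :
    regionB x d l = pathRegion X (univ.image (start l)) (boundedPositions X d m) := by
  refine ext_upTri_downTri (fun p => ?_) fun p => ?_
  · have hstart := bounds_of_mem_image_start hl (p := p)
    rw [regionB, mem_sdiff, upTri_mem_fullRegion hX, upTri_mem_pathRegion, mem_boundedPositions,
      upTri_mem_dents]
    simp only [InBounds, left]
    by_cases hp : p ∈ univ.image (start l)
    · have := hstart hp
      simp only [hp, not_true_eq_false, and_false, not_false_eq_true, true_or, true_and,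
        and_true]
      omega
    · simp only [hp, not_false_eq_true, and_true, false_or]
      omega
  · rw [regionB, mem_sdiff, downTri_mem_fullRegion hX, downTri_mem_pathRegion,
      mem_boundedPositions, and_iff_left (downTri_notMem_dents p)]

theorem isFrontier_start (hX : X + m = x + d) (hmono : StrictMono l)
    (hl : ∀ i, 1 ≤ l i ∧ l i ≤ d) : IsFrontier X d (start l) (boundedPositions X d m) where
  inBounds _ he := mem_boundedPositions.1 he
  ordered i j hij := by
    have := hmono hij
    simp only [start]
    omega
  position k := by
    have := hl k
    simp only [start]
    omega
  left_notMem k := by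
    simp only [mem_boundedPositions, InBounds, left, start]
    omega
  missing _ he hV := absurd (mem_boundedPositions.2 he) hV

theorem tilingGF_regionB_eq_det {K : Type*} [Field K] (q : K) (hX : X + m = x + d)
    (hmono : StrictMono l) (hl : ∀ i, 1 ≤ l i ∧ l i ≤ d) :
    tilingGF q (regionB x d l) = (pathMatrix q X (start l)).det := by
  rw [regionB_eq_pathRegion hX hl, (isFrontier_start hX hmono hl).tilingGF_eq_det]

end RegionB

section StartDeterminant

variable {K : Type*} [Field K] {q : K}

/-- A vector of the plane chosen such that the wedge products are the symmetric `q`-integers. -/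
noncomputable def symPoint (q : K) (n : ℤ) : K × K := (q ^ n / (q - q⁻¹), q ^ (-n))

theorem wedge_symPoint (hq : q ≠ 0) (a b : ℤ) :
    wedge (symPoint q a) (symPoint q b) = symInt q (a - b) := by
  simp only [wedge, symPoint, symInt, neg_sub, zpow_sub₀ hq, zpow_neg]
  ring

theorem det_pathMatrix_start (hq : q ≠ 0) (h2 : (2 : K) ≠ 0) (hfin : ¬ IsOfFinOrder q)
    {X m : ℕ} {l : Fin m → ℕ} (hl : ∀ k, l k ≤ X + m) :
    (pathMatrix q X (start l)).det =
      (∏ k, rowFactor q X m (l k)) * ((∏ k : Fin m, 2 ^ (k : ℕ)) *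
        ((∏ i, ∏ j ∈ Ioi i, symInt q (2 * (l j - l i))) *
          ∏ k : Fin m, ∏ u ∈ Ico (k : ℕ) (m - 1), symInt q (2 * (X + 2 + u) - k))) := by
  have hmatrix : pathMatrix q X (start l) = .of fun k y : Fin m => rowFactor q X m (l k) *
      Matrix.of (fun k y : Fin m => 2 ^ (y : ℕ) * (Matrix.of fun k y : Fin m =>
        wedgeProd (fun u => symPoint q (2 * (X + 2 + u))) (fun u => symPoint q u) m y
          (symPoint q (2 * l k))) k y) k y := by
    ext k y
    simp only [pathMatrix, start, Matrix.of_apply,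
      pathWeight_eq_rowFactor_mul hq h2 hfin (hl k) y.2, wedgeProd, wedge_symPoint hq]
  rw [hmatrix, Matrix.det_mul_column, Matrix.det_mul_row, det_wedgeProd]
  · simp only [wedge_symPoint hq, mul_sub]
  · intro i j hij _
    rw [wedge_symPoint hq]
    exact symInt_ne_zero hq hfin (by omega)

end StartDeterminant

section ProductFormula

variable {K : Type*} [Field K] {q : K} {x d m X : ℕ} {l : Fin m → ℕ}

theorem succ_le_apply_of_strictMono (hmono : StrictMono l) (hl : ∀ k, 1 ≤ l k) (k : Fin m) :
    (k : ℕ) + 1 ≤ l k := by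
  obtain ⟨n, hn⟩ := k
  induction n with
  | zero => exact hl _
  | succ n ih => exact (ih (by omega)).trans_lt (hmono (Nat.lt_succ_self n))

/-- The part of the product formula with the index `k`, where the brackets `[n]_{q²}` are replaced
by the values `φ n` of an arbitrary function. -/
noncomputable def bracketFactor (φ : ℤ → K) (X : ℕ) (l : Fin m → ℕ) (k : Fin m) : K :=
  (∏ i ∈ Iio k, φ (2 * ((l k : ℤ) - l i))) * (φ (2 * (X + idx k)) * φ (2 * (X + idx k + 1))) *
    (∏ j ∈ Icc 1 (idx k - 1), φ (2 * X + idx k + j + 1)) *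
    (∏ j ∈ Icc 1 (l k - idx k), φ (2 * (X + idx k + j + 1)) * φ (2 * (X - idx k - j + m + 1))) /
    ∏ t ∈ Icc 1 (2 * (l k : ℤ)), φ t

theorem bracketFactor_mul (φ ψ : ℤ → K) (X : ℕ) (l : Fin m → ℕ) (k : Fin m) :
    bracketFactor (fun n => φ n * ψ n) X l k = bracketFactor φ X l k * bracketFactor ψ X l k := by
  simp only [bracketFactor, prod_mul_distrib, div_eq_mul_inv, mul_inv]
  ring

theorem bracketFactor_congr {φ ψ : ℤ → K} (hφ : ∀ n, 0 ≤ n → φ n = ψ n) (hmono : StrictMono l)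
    (hX : ∀ k, l k ≤ X + m) (k : Fin m) : bracketFactor φ X l k = bracketFactor ψ X l k := by
  have := hX k
  rw [bracketFactor, bracketFactor, hφ _ (by rw [idx]; omega), hφ _ (by rw [idx]; omega),
    prod_congr rfl fun i hi => hφ _ (by have := hmono (mem_Iio.1 hi); omega),
    prod_congr rfl fun j hj => hφ _ (by have := mem_Icc.1 hj; rw [idx]; omega),
    prod_congr rfl fun j hj => congrArg₂ (· * ·)
      (hφ (2 * (X + idx k + j + 1)) (by have := mem_Icc.1 hj; rw [idx]; omega))
      (hφ (2 * (X - idx k - j + m + 1)) (by have := mem_Icc.1 hj; omega)),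
    prod_congr rfl fun t ht => hφ _ (by have := mem_Icc.1 ht; omega)]

theorem xTilde_zero (hX : X + m = x + d) (hmd : m ≤ d) : xTilde x 0 d m 0 = X := by
  simp only [xTilde, ePrime]
  omega

theorem Q_eq_prod_bracketFactor (q : K) (hX : X + m = x + d) (hmd : m ≤ d) :
    Q q x 0 d l ![] = 2 ^ (-FPrime l ![]) * q ^ (-EPrime x 0 d l ![]) *
      ∏ k, bracketFactor (qInt (q ^ 2)) X l k := by
  have hempty : Icc (1 : ℤ) (1 / 2) = ∅ := rfl
  simp only [Q, xTilde_zero hX hmd, bracketFactor, qFact, filter_gt_eq_Iio, univ_eq_empty,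
    prod_empty, prod_const_one, Nat.cast_zero, add_zero, zero_add, hempty, mul_one, one_mul,
    prod_mul_distrib, div_eq_mul_inv, prod_inv_distrib, inv_one]
  ac_rfl

section Exponent

theorem zpow_sum {ι : Type*} (hq : q ≠ 0) (s : Finset ι) (f : ι → ℤ) :
    q ^ ∑ i ∈ s, f i = ∏ i ∈ s, q ^ f i := by
  classical
  induction s using Finset.induction_on with
  | empty => simp
  | insert a s ha ih => rw [sum_insert ha, prod_insert ha, zpow_add₀ hq, ih]

theorem two_mul_bracketSum {a b : ℤ} (hab : a ≤ b + 1) :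
    2 * bracketSum b a = (b - a + 1) * (a + b) := by
  have hreflect : bracketSum b a = ∑ k ∈ Icc a b, (a + b - k) :=
    sum_nbij' (a + b - ·) (a + b - ·) (by simp only [mem_Icc]; omega)
      (by simp only [mem_Icc]; omega) (by simp) (by simp) (by simp)
  rw [two_mul]
  nth_rw 2 [hreflect]
  rw [bracketSum, ← sum_add_distrib]
  simp only [add_sub_cancel, sum_const, Int.card_Icc, nsmul_eq_mul]
  rw [Int.toNat_of_nonneg (by omega)]
  ring

theorem two_mul_sum_Icc_one_add {n : ℤ} (hn : 0 ≤ n) (c : ℤ) :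
    2 * ∑ j ∈ Icc 1 n, (c + j) = n * (2 * c + n + 1) := by
  have hsum := two_mul_bracketSum (show 1 ≤ n + 1 by omega)
  rw [bracketSum] at hsum
  rw [sum_add_distrib, mul_add, hsum, sum_const, Int.card_Icc, nsmul_eq_mul,
    Int.toNat_of_nonneg (by omega)]
  ring

theorem sum_sum_Iio_sub (f : Fin m → ℤ) :
    ∑ k, ∑ i ∈ Iio k, (f k - f i) = ∑ k : Fin m, (2 * k - (m - 1)) * f k := by
  have hswap : ∑ k, ∑ i ∈ Iio k, f i = ∑ i, ∑ _k ∈ Ioi i, f i := sum_comm' (by simp)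
  simp only [sum_sub_distrib, hswap, sum_const, Fin.card_Ioi, Fin.card_Iio, nsmul_eq_mul]
  rw [← sum_sub_distrib]
  refine sum_congr rfl fun k _ => ?_
  rw [show ((m - 1 - (k : ℕ) : ℕ) : ℤ) = m - 1 - k by omega]
  ring

theorem sum_idx_quadratic (m : ℕ) :
    ∑ k : Fin m, (6 * idx k ^ 2 - 4 * m * idx k - (m + 1)) = 0 := by
  have hsum (n : ℕ) : ∑ k ∈ range n, (6 * ((k : ℤ) + 1) ^ 2 - 4 * m * (k + 1) - (m + 1)) =
      (n : ℤ) * (n + 1) * (2 * n + 1) - 2 * m * (n * (n + 1)) - n * (m + 1) := by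
    induction n with
    | zero => simp
    | succ n ih =>
      rw [sum_range_succ, ih]
      push_cast
      ring
  simp only [idx]
  rw [Fin.sum_univ_eq_sum_range fun k : ℕ => 6 * ((k : ℤ) + 1) ^ 2 - 4 * m * (k + 1) - (m + 1),
    hsum]
  ring

/-- The exponent of `q` in `bracketFactor (qInt (q ^ 2)) X l k`, where `[n]_{q²}` contributes
`n - 1`. -/
noncomputable def bracketExponent (X : ℕ) (l : Fin m → ℕ) (k : Fin m) : ℤ :=
  ∑ i ∈ Iio k, (2 * ((l k : ℤ) - l i) - 1) +
    (2 * (X + idx k) - 1 + (2 * (X + idx k + 1) - 1)) +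
    ∑ j ∈ Icc 1 (idx k - 1), (2 * X + idx k + j + 1 - 1) +
    ∑ j ∈ Icc 1 (l k - idx k),
      (2 * (X + idx k + j + 1) - 1 + (2 * (X - idx k - j + m + 1) - 1)) -
    ∑ t ∈ Icc 1 (2 * (l k : ℤ)), (t - 1)

theorem bracketFactor_zpow (hq : q ≠ 0) (X : ℕ) (l : Fin m → ℕ) (k : Fin m) :
    bracketFactor (fun n => q ^ (n - 1)) X l k = q ^ bracketExponent X l k := by
  simp only [bracketFactor, bracketExponent, ← zpow_add₀ hq, ← zpow_sum hq, ← zpow_sub₀ hq]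

theorem two_mul_bracketExponent (X : ℕ) {k : Fin m} (hk : (k : ℕ) + 1 ≤ l k) :
    2 * bracketExponent X l k = 4 * ∑ i ∈ Iio k, ((l k : ℤ) - l i) +
      (8 * X + 8 * idx k + (idx k - 1) * (4 * X + 3 * idx k - 2) +
        2 * (l k - idx k) * (4 * X + 2 * m + 2) - 2 * l k * (2 * l k - 1)) := by
  have hrising : ∑ j ∈ Icc 1 (idx k - 1), (2 * X + idx k + j + 1 - 1) =
      ∑ j ∈ Icc 1 (idx k - 1), (2 * X + idx k + j) := by simp only [add_sub_cancel_right]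
  have hconst : ∑ j ∈ Icc 1 (l k - idx k),
      (2 * (X + idx k + j + 1) - 1 + (2 * (X - idx k - j + m + 1) - 1)) =
      (l k - idx k) * (4 * X + 2 * m + 2) := by
    rw [sum_congr rfl fun j _ => show _ = (4 * X + 2 * m + 2 : ℤ) by ring, sum_const, Int.card_Icc,
      nsmul_eq_mul, Int.toNat_of_nonneg (by rw [idx]; omega)]
    ring
  have hfact : ∑ t ∈ Icc 1 (2 * (l k : ℤ)), (t - 1) = ∑ t ∈ Icc 1 (2 * (l k : ℤ)), (-1 + t) :=
    sum_congr rfl fun t _ => by ring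
  have hk1 : idx k - 1 = k := by simp only [idx, add_sub_cancel_right]
  have hrising_eq := two_mul_sum_Icc_one_add (show 0 ≤ idx k - 1 by omega) (2 * X + idx k)
  have hfact_eq := two_mul_sum_Icc_one_add (show (0 : ℤ) ≤ 2 * l k by omega) (-1)
  rw [bracketExponent, hrising, hconst, hfact, sum_sub_distrib, ← mul_sum, sum_const,
    Fin.card_Iio, nsmul_one, ← hk1]
  linear_combination hrising_eq - hfact_eq

theorem sum_bracketExponent (hX : X + m = x + d) (hmd : m ≤ d)
    (hk : ∀ k : Fin m, (k : ℕ) + 1 ≤ l k) :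
    ∑ k, bracketExponent X l k = EPrime x 0 d l ![] := by
  have hX' : (x : ℤ) = X + m - d := by omega
  have he : ePrime 0 d m 0 = 0 := by
    rw [ePrime]
    omega
  have hfExp : 2 * fExp (2 * x + 1 + 2 * d - m) 1 m = ∑ _k : Fin m, (4 * X + m + 3 : ℤ) := by
    obtain ⟨c, hc⟩ : (2 : ℤ) ∣ m * (m - 1) := (Int.even_mul_pred_self (m : ℤ)).two_dvd
    rw [fExp, Int.mul_ediv_cancel' ⟨m * (2 * x + 2 * d) - 3 * c, by linear_combination -3 * hc⟩,
      sum_const, card_univ, Fintype.card_fin, nsmul_eq_mul, hX']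
    ring
  have hbracket (k : Fin m) : 2 * bracketSum (2 * x + 1 + 2 * d - m - (m - idx k + 1))
      (2 * x + 1 + 2 * (d - l k) - 2 * (m - idx k)) =
      (2 * l k - idx k) * (4 * X + 1 + 3 * idx k - 2 * l k) := by
    have := hk k
    rw [two_mul_bracketSum (by rw [idx]; omega), hX']
    ring
  have hdouble : 2 * ∑ k, bracketExponent X l k = 2 * EPrime x 0 d l ![] := by
    simp only [EPrime, he, Nat.cast_zero, add_zero, sub_zero, zero_add, univ_eq_empty, sum_empty]
    rw [mul_add, hfExp, mul_sum, mul_sum, sum_congr rfl fun k _ => hbracket k, ← sum_add_distrib,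
      sum_congr rfl fun k _ => two_mul_bracketExponent X (hk k), sum_add_distrib, ← mul_sum,
      sum_sum_Iio_sub, mul_sum, ← sum_add_distrib, ← sub_eq_zero, ← sum_sub_distrib,
      ← sum_idx_quadratic m]
    refine sum_congr rfl fun k _ => ?_
    rw [idx]
    ring
  omega

end Exponent

theorem Q_eq_prod_bracketFactor_symInt (hq : q ≠ 0) (hfin : ¬ IsOfFinOrder q) (hX : X + m = x + d)
    (hmono : StrictMono l) (hl : ∀ k : Fin m, (k : ℕ) + 1 ≤ l k ∧ l k ≤ d) (hmd : m ≤ d) :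
    Q q x 0 d l ![] = 2 ^ (-FPrime l ![]) * ∏ k, bracketFactor (symInt q) X l k := by
  have hfactor (k : Fin m) : bracketFactor (qInt (q ^ 2)) X l k =
      q ^ bracketExponent X l k * bracketFactor (symInt q) X l k := by
    rw [← bracketFactor_zpow hq, ← bracketFactor_mul]
    exact bracketFactor_congr (fun n => qInt_sq_eq_zpow_mul_symInt hq hfin) hmono
      (fun k => by have := (hl k).2; omega) k
  rw [Q_eq_prod_bracketFactor q hX hmd, prod_congr rfl fun k _ => hfactor k, prod_mul_distrib,
    ← zpow_sum hq, sum_bracketExponent hX hmd fun k => (hl k).1, mul_assoc, ← mul_assoc (q ^ _),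
    ← zpow_add₀ hq, neg_add_cancel, zpow_zero, one_mul]

theorem bracketFactor_symInt (hq : q ≠ 0) (h2 : (2 : K) ≠ 0) (hfin : ¬ IsOfFinOrder q) {k : Fin m}
    (hk : (k : ℕ) + 1 ≤ l k) (hX : l k ≤ X + m) :
    bracketFactor (symInt q) X l k =
      rowFactor q X m (l k) * 2 ^ (2 * l k) * (symFact q 2 (X + m - idx k) / symFact q 2 (X + k)) *
        ((∏ i ∈ Iio k, symInt q (2 * ((l k : ℤ) - l i))) *
          ∏ j ∈ Icc 1 (k : ℤ), symInt q (2 * X + k + 2 + j)) := by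
  have hk1 : idx k = k + 1 := rfl
  have hup : symInt q (2 * (X + idx k)) * symInt q (2 * (X + idx k + 1)) *
      ∏ j ∈ Icc 1 (l k - idx k), symInt q (2 * (X + idx k + j + 1)) =
      symFact q 2 (X + 1 + l k) / symFact q 2 (X + k) := by
    have hprod := prod_Icc_one_add (fun t => symInt q (2 * t)) (X + idx k + 1) (l k - idx k)
    simp only [add_right_comm _ (1 : ℤ)] at hprod
    rw [hprod, ← prod_Ioc_symInt_eq_div hq hfin two_pos (by omega) (by omega), mul_assoc,
      show (X + k : ℤ) = X + idx k + 1 - 1 - 1 by omega,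
      prod_Ioc_sub_one (fun t => symInt q (2 * t)) (by omega),
      prod_Ioc_sub_one (fun t => symInt q (2 * t)) (by omega), add_sub_cancel_right]
    congr 4
    omega
  have hdown : ∏ j ∈ Icc 1 (l k - idx k), symInt q (2 * (X - idx k - j + m + 1)) =
      symFact q 2 (X + m - idx k) / symFact q 2 (X + m - l k) := by
    rw [← prod_Ioc_symInt_eq_div hq hfin two_pos (by omega) (by omega)]
    convert prod_Icc_one_sub (fun t => symInt q (2 * t)) (X + m - idx k) (l k - idx k) using 2
    · ring_nf
    · congr 1
      ring
  have htri : ∏ j ∈ Icc 1 (idx k - 1), symInt q (2 * X + idx k + j + 1) =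
      ∏ j ∈ Icc 1 (k : ℤ), symInt q (2 * X + k + 2 + j) := by
    rw [hk1, add_sub_cancel_right]
    exact prod_congr rfl fun j _ => by ring_nf
  have hfact : ∏ t ∈ Icc 1 (2 * (l k : ℤ)), symInt q t = symFact q 1 (2 * l k) := by
    simpa only [symFact, one_mul, zero_add] using prod_Icc_one_add (symInt q) 0 (2 * l k)
  calc bracketFactor (symInt q) X l k
      = symFact q 2 (X + 1 + l k) / symFact q 2 (X + k) *
          (symFact q 2 (X + m - idx k) / symFact q 2 (X + m - l k)) / symFact q 1 (2 * l k) *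
          ((∏ i ∈ Iio k, symInt q (2 * ((l k : ℤ) - l i))) *
            ∏ j ∈ Icc 1 (k : ℤ), symInt q (2 * X + k + 2 + j)) := by
        rw [bracketFactor, prod_mul_distrib, htri, hdown, hfact, ← hup]
        ring
    _ = _ := by
        rw [rowFactor]
        field_simp

theorem prod_symFact_rev_div (hq : q ≠ 0) (hfin : ¬ IsOfFinOrder q) (X m : ℕ) :
    ∏ k : Fin m, symFact q 2 (X + m - idx k) / symFact q 2 (X + k) = 1 := by
  have hval (k : Fin m) : (X + m - idx k : ℤ) = X + (Fin.rev k : ℕ) := by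
    rw [Fin.val_rev, idx]
    omega
  have hrev : ∏ k : Fin m, symFact q 2 (X + (Fin.rev k : ℕ)) =
      ∏ k : Fin m, symFact q 2 (X + (k : ℕ)) :=
    Equiv.prod_comp Fin.revPerm fun k : Fin m => symFact q 2 (X + (k : ℕ))
  simp only [hval, prod_div_distrib, hrev]
  exact div_self (prod_ne_zero_iff.2 fun k _ => symFact_ne_zero hq hfin two_pos _)

theorem prod_symInt_triangle (q : K) (X m : ℕ) :
    ∏ k : Fin m, ∏ j ∈ Icc 1 (k : ℤ), symInt q (2 * X + k + 2 + j) =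
      ∏ k : Fin m, ∏ u ∈ Ico (k : ℕ) (m - 1), symInt q (2 * (X + 2 + u) - k) := by
  rw [Fin.prod_univ_eq_prod_range fun k : ℕ => ∏ j ∈ Icc 1 (k : ℤ), symInt q (2 * X + k + 2 + j),
    Fin.prod_univ_eq_prod_range fun k : ℕ =>
      ∏ u ∈ Ico k (m - 1), symInt q (2 * (X + 2 + u) - k), prod_sigma', prod_sigma']
  refine prod_nbij' (fun p => ⟨(p.1 - p.2).toNat, p.1 - 1⟩) (fun p => ⟨p.2 + 1, p.2 + 1 - p.1⟩)
    ?_ ?_ ?_ ?_ ?_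
  · rintro ⟨k, j⟩
    simp only [mem_sigma, mem_range, mem_Icc, mem_Ico]
    omega
  · rintro ⟨k, u⟩
    simp only [mem_sigma, mem_range, mem_Icc, mem_Ico]
    omega
  · rintro ⟨k, j⟩
    simp only [mem_sigma, mem_range, mem_Icc, Sigma.mk.injEq, heq_eq_eq]
    omega
  · rintro ⟨k, u⟩
    simp only [mem_sigma, mem_range, mem_Ico, Sigma.mk.injEq, heq_eq_eq]
    omega
  · rintro ⟨k, j⟩
    simp only [mem_sigma, mem_range, mem_Icc]
    intro hkj
    congr 1
    omega

theorem two_zpow_neg_FPrime (h2 : (2 : K) ≠ 0) (l : Fin m → ℕ) :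
    (2 : K) ^ (-FPrime l ![]) * ∏ k, 2 ^ (2 * l k) = ∏ k : Fin m, 2 ^ (k : ℕ) := by
  have hF : -FPrime l ![] = ∑ k : Fin m, ((k : ℤ) - (2 * l k : ℕ)) := by
    have hm : ((m : ℕ) : ℤ) = ∑ _k : Fin m, 1 := by simp
    simp only [FPrime, Nat.cast_zero, zero_add, one_mul, univ_eq_empty, sum_empty, add_zero]
    rw [hm, ← sum_add_distrib, ← sum_neg_distrib]
    refine sum_congr rfl fun k _ => ?_
    rw [idx]
    push_cast
    ring
  rw [hF, zpow_sum h2, ← prod_mul_distrib]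
  refine prod_congr rfl fun k _ => ?_
  rw [← zpow_natCast, ← zpow_natCast, ← zpow_add₀ h2, sub_add_cancel]

theorem tilingGF_regionB_eq_prod_bracketFactor (hq : q ≠ 0) (h2 : (2 : K) ≠ 0)
    (hfin : ¬ IsOfFinOrder q) (hX : X + m = x + d) (hmono : StrictMono l)
    (hl : ∀ k : Fin m, (k : ℕ) + 1 ≤ l k ∧ l k ≤ d) :
    tilingGF q (regionB x d l) = 2 ^ (-FPrime l ![]) * ∏ k, bracketFactor (symInt q) X l k := by
  have hlX (k : Fin m) : l k ≤ X + m := by have := (hl k).2; omega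
  have hswap : ∏ k, ∏ i ∈ Iio k, symInt q (2 * ((l k : ℤ) - l i)) =
      ∏ i, ∏ k ∈ Ioi i, symInt q (2 * ((l k : ℤ) - l i)) := prod_comm' (by simp)
  rw [tilingGF_regionB_eq_det q hX hmono fun k => ⟨by have := (hl k).1; omega, (hl k).2⟩,
    det_pathMatrix_start hq h2 hfin hlX,
    prod_congr rfl fun k _ => bracketFactor_symInt hq h2 hfin (hl k).1 (hlX k)]
  simp only [prod_mul_distrib]
  rw [prod_symFact_rev_div hq hfin, hswap, prod_symInt_triangle, ← two_zpow_neg_FPrime h2 l]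
  ring

end ProductFormula

theorem not_isOfFinOrder_ratFunc_X (F : Type*) [Field F] :
    ¬ IsOfFinOrder (RatFunc.X : RatFunc F) := by
  rw [isOfFinOrder_iff_pow_eq_one]
  rintro ⟨n, hn, h⟩
  rw [← RatFunc.algebraMap_X, ← map_pow, map_eq_one_iff _ (RatFunc.algebraMap_injective F)] at h
  have := congrArg Polynomial.natDegree h
  rw [Polynomial.natDegree_X_pow, Polynomial.natDegree_one] at this
  omega

end HalvedHexagon

open HalvedHexagon in
theorem mainTheorem8_general {K : Type*} [Field K] {q : K} (hq : q ≠ 0) (h2 : (2 : K) ≠ 0)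
    (hfin : ¬ IsOfFinOrder q) (x d : ℕ) {m : ℕ} {l : Fin m → ℕ} (hmono : StrictMono l)
    (hl : ∀ i, 1 ≤ l i ∧ l i ≤ d) :
    tilingGF q (regionB x d l) = Q q x 0 d l ![] := by
  have hlk (k : Fin m) : (k : ℕ) + 1 ≤ l k ∧ l k ≤ d :=
    ⟨succ_le_apply_of_strictMono hmono (fun i => (hl i).1) k, (hl k).2⟩
  have hmd : m ≤ d := by
    obtain _ | m := m
    · exact d.zero_le
    · exact (hlk (Fin.last m)).1.trans (hlk (Fin.last m)).2
  obtain ⟨X, hX⟩ : ∃ X, X + m = x + d := ⟨x + d - m, by omega⟩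
  rw [tilingGF_regionB_eq_prod_bracketFactor hq h2 hfin hX hmono hlk,
    Q_eq_prod_bracketFactor_symInt hq hfin hX hmono hlk hmd]

theorem mainTheorem8 (x d m : ℕ) (hmd : m ≤ d) (l : Fin m → ℕ) (hmono : StrictMono l)
    (hl : ∀ i, 1 ≤ l i ∧ l i ≤ d) :
    HalvedHexagon.tilingGF (RatFunc.X : RatFunc ℚ) (HalvedHexagon.regionB x d l) =
      HalvedHexagon.Q (RatFunc.X : RatFunc ℚ) x 0 d l ![] :=
  mainTheorem8_general RatFunc.X_ne_zero two_ne_zero (HalvedHexagon.not_isOfFinOrder_ratFunc_X ℚ)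
    x d hmono hl
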